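/- Let $m\ge 2$. Let $\langle Y,Z\rangle=-Y_0Z_0+Y_1Z_1+\dots+Y_{m+3}Z_{m+3}$ on $\mathbb R^{m+4}_1$, extended complex-bilinearly to $\mathbb C^{m+4}$, and let $Q^{m+2}_+=\{[Z]\in\mathbb CP^{m+3}:\langle Z,Z\rangle=0,\ \langle Z,\bar Z\rangle>0\}$. A point $[\xi_1-i\xi_2]$ of $Q^{m+2}_+$ represents the $m$-sphere $\{x\in S^{m+2}:\langle(1,x),\xi_1\rangle=\langle(1,x),\xi_2\rangle=0\}$. Let $\overline M$ be a Riemann surface and $[\xi]:\overline M\to Q^{m+2}_+$ a holomorphic 1-isotropic curve, i.e. a holomorphic map whose local holomorphic lifts $\xi=\xi_1-i\xi_2$ satisfy $\langle d\xi,d\xi\rangle=0$. Put $V(q)=\mathrm{Span}_{\mathbb R}\{\xi_1,\xi_2,d\xi_1,d\xi_2\}_q$, and let the envelope of the corresponding 2-parameter family of $m$-spheres be $$\widehat M=\{(q,x)\in\overline M\times S^{m+2}:\ (1,x)\in V(q)^\perp\},\qquad (q,x)\mapsto x .$$ For a smooth map $x$ of an $m$-manifold into $S^{m+2}\subset\mathbb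 R^{m+3}$ that is an immersion at a point, call $x$ Wintgen ideal at this point if there are an orthonormal tangent basis $e_1,\dots,e_m$, an orthonormal normal basis $n_1,n_2$ and reals $\lambda_1,\lambda_2,\mu_0$ for which the shape operators have matrices $A_{n_1}=\lambda_1 I+\mu_0(E_{12}+E_{21})$ and $A_{n_2}=\lambda_2 I+\mu_0(E_{11}-E_{22})$. Its mean curvature sphere there is $[\xi_1-i\xi_2]$ with $\xi_r=(H^r,\,n_r+H^r x)$, where $n_1,n_2$ is an orthonormal normal basis and $H^r$ are the components of the mean curvature vector (it is determined up to the orientation of the normal plane). Then: 1. Near every $q_0\in\overline M$ at which the differential of $[\xi]$ is positive, i.e. the horizontal part $d\xi-\frac{\langle d\xi,\bar\xi\rangle}{\langle\xi,\bar\xi\rangle}\xi$ has positive norm $\langle\cdot,\bar\cdot\rangle$ on nonzero vectors, there is a smooth pseudo-orthonormal frame $e_0,e_1,\dots,e_{m-1}$ of $V^\perp$, with $\langle e_0,e_0\rangle=-1$. 2. For every such frame over an open set $U\subset\overline M$, let $\hat x(q,\Theta)\in S^{m+2}$ be the point with $[(1,\hat x)]=[e_0(q)+\sum_{j=1}^{m-1}\Theta_je_j(q)]$.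 Then $\hat x$ is smooth on $U\times S^{m-2}$, and $(q,\Theta)\mapsto(q,\hat x(q,\Theta))$ is a bijection of $U\times S^{m-2}$ onto the part of $\widehat M$ over $U$. At every point $(q,\Theta)$ where $\hat x$ is immersed, it is Wintgen ideal and its mean curvature sphere is $[\xi(q)]$. 3. More generally, let $N$ be an $m$-dimensional manifold and $(\pi,f):N\to\overline M\times S^{m+2}$ a smooth map with values in $\widehat M$. At every point $p$ where $f$ is immersed, $f$ is Wintgen ideal with mean curvature sphere $[\xi(\pi(p))]$. -/

import Mathlib

open scoped Manifold ContDiff LinearAlgebra.Projectivization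

noncomputable section

namespace Wintgen

/-! ### The light-cone model

Throughout, `m = k + 2` with `k : ℕ` is the dimension of the submanifolds. The unit sphere
`S^{m+2}` lies in `EuclideanSpace ℝ (Fin (k + 5))`, and the Lorentz space and its
complexification are `Fin (k + 6) → ℝ` and `Fin (k + 6) → ℂ`. -/

/-- The Lorentz product `-Y₀Z₀ + Y₁Z₁ + ⋯ + YₙZₙ`. Over `ℂ` it is the complex bilinear
(not Hermitian) extension. -/
def lorentz {R : Type*} [CommRing R] {n : ℕ} (Y Z : Fin (n + 1) → R) : R :=
  -(Y 0 * Z 0) + ∑ i : Fin n, Y i.succ * Z i.succ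

/-- A real vector viewed in the complexification. -/
def toC {n : ℕ} (y : Fin n → ℝ) : Fin n → ℂ := fun i => (y i : ℂ)

/-- The vector `(t, x)`. -/
def pair {n : ℕ} (t : ℝ) (x : EuclideanSpace ℝ (Fin n)) : Fin (n + 1) → ℝ :=
  Fin.cons t (fun i => x i)

/-- The quadric `Q^{m+2}_+ = {[Z] : ⟨Z, Z⟩ = 0, ⟨Z, conj Z⟩ > 0}`. -/
def Qplus (k : ℕ) : Set (ℙ ℂ (Fin (k + 6) → ℂ)) :=
  {P | ∃ (Z : Fin (k + 6) → ℂ) (hZ : Z ≠ 0), P = Projectivization.mk ℂ Z hZ ∧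
    lorentz Z Z = 0 ∧ 0 < (lorentz Z (star Z)).re}

/-! ### Holomorphic 1-isotropic curves -/

section Curve

variable {k : ℕ} {M : Type*} [TopologicalSpace M] [ChartedSpace ℂ M]

/-- `ζ` is a holomorphic lift of `ξ : M → ℂP^{m+3}` on the open set `U`. -/
structure IsHolomorphicLift (ξ : M → ℙ ℂ (Fin (k + 6) → ℂ)) (U : Set M)
    (ζ : M → Fin (k + 6) → ℂ) : Prop where
  isOpen : IsOpen U
  holomorphic : MDifferentiableOn 𝓘(ℂ) 𝓘(ℂ, Fin (k + 6) → ℂ) ζ U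
  lifts : ∀ q ∈ U, ∃ h : ζ q ≠ 0, ξ q = Projectivization.mk ℂ (ζ q) h

/-- The complex differential `v ↦ dζ(v)` of a vector-valued function on a Riemann surface. -/
def dlift (ζ : M → Fin (k + 6) → ℂ) (q : M) (v : TangentSpace 𝓘(ℂ) q) : Fin (k + 6) → ℂ :=
  mfderiv 𝓘(ℂ) 𝓘(ℂ, Fin (k + 6) → ℂ) ζ q v

/-- `ξ` is a holomorphic map into `Q^{m+2}_+` whose complex differential is isotropic. -/
structure IsOneIsotropicCurve (ξ : M → ℙ ℂ (Fin (k + 6) → ℂ)) : Prop where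
  mem_Qplus : ∀ q, ξ q ∈ Qplus k
  exists_lift : ∀ q, ∃ (U : Set M) (ζ : M → Fin (k + 6) → ℂ), q ∈ U ∧
    IsHolomorphicLift ξ U ζ ∧
    ∀ p ∈ U, ∀ v : TangentSpace 𝓘(ℂ) p, lorentz (dlift ζ p v) (dlift ζ p v) = 0

/-- The horizontal part `dζ - (⟨dζ, conj ζ⟩ / ⟨ζ, conj ζ⟩) ζ`. -/
def horizontal (ζ : M → Fin (k + 6) → ℂ) (q : M) (v : TangentSpace 𝓘(ℂ) q) :
    Fin (k + 6) → ℂ :=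
  dlift ζ q v - (lorentz (dlift ζ q v) (star (ζ q)) / lorentz (ζ q) (star (ζ q))) • ζ q

/-- The differential of `ξ` at `q` is positive for the Hermitian metric of `Q^{m+2}_+`. -/
def IsSpacelikeAt (ξ : M → ℙ ℂ (Fin (k + 6) → ℂ)) (q : M) : Prop :=
  ∃ (U : Set M) (ζ : M → Fin (k + 6) → ℂ), q ∈ U ∧ IsHolomorphicLift ξ U ζ ∧
    ∀ v : TangentSpace 𝓘(ℂ) q, v ≠ 0 →
      0 < (lorentz (horizontal ζ q v) (star (horizontal ζ q v))).re

/-! ### The envelope -/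

/-- The real orthogonal complement `V(q)^⊥` of `V(q) = Span_ℝ {ξ₁, ξ₂, dξ₁, dξ₂}`, where
`ξ₁ - i ξ₂` is a local lift of `ξ`; the space does not depend on the lift. -/
def envelopeSpace (ξ : M → ℙ ℂ (Fin (k + 6) → ℂ)) (q : M) : Submodule ℝ (Fin (k + 6) → ℝ) where
  carrier := {y | ∀ (U : Set M) (ζ : M → Fin (k + 6) → ℂ), q ∈ U → IsHolomorphicLift ξ U ζ →
    lorentz (toC y) (ζ q) = 0 ∧
      ∀ v : TangentSpace 𝓘(ℂ) q, lorentz (toC y) (dlift ζ q v) = 0}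
  zero_mem' := by
    intro U ζ _ _
    simp [lorentz, toC]
  add_mem' := by
    intro a b ha hb U ζ hq hζ
    have key : ∀ Z : Fin (k + 6) → ℂ,
        lorentz (toC (a + b)) Z = lorentz (toC a) Z + lorentz (toC b) Z := by
      intro Z
      simp only [lorentz, toC, Pi.add_apply, Complex.ofReal_add, add_mul, Finset.sum_add_distrib]
      ring
    obtain ⟨a1, a2⟩ := ha U ζ hq hζ
    obtain ⟨b1, b2⟩ := hb U ζ hq hζ
    exact ⟨by rw [key, a1, b1, add_zero], fun v => by rw [key, a2, b2, add_zero]⟩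
  smul_mem' := by
    intro c a ha U ζ hq hζ
    have key : ∀ Z : Fin (k + 6) → ℂ,
        lorentz (toC (c • a)) Z = (c : ℂ) * lorentz (toC a) Z := by
      intro Z
      simp only [lorentz, toC, Pi.smul_apply, smul_eq_mul, Complex.ofReal_mul, mul_add,
        Finset.mul_sum, mul_neg, mul_assoc]
    obtain ⟨a1, a2⟩ := ha U ζ hq hζ
    exact ⟨by rw [key, a1, mul_zero], fun v => by rw [key, a2, mul_zero]⟩

/-- The envelope of the family of `m`-spheres `{x ∈ S^{m+2} : ⟨(1, x), ξ(q)⟩ = 0}`, `q ∈ M`, as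
the set of pairs `(q, x)` for which `⟨(1, x), ξ⟩` and its differential in the parameter
vanish at `q`; that is, `[(1, x)]` is a light-like direction of `V(q)^⊥`. -/
def envelope (ξ : M → ℙ ℂ (Fin (k + 6) → ℂ)) : Set (M × EuclideanSpace ℝ (Fin (k + 5))) :=
  {z | ‖z.2‖ = 1 ∧ pair 1 z.2 ∈ envelopeSpace ξ z.1}

/-- `e₀, e₁, …, e_{m-1}` is a smooth pseudo-orthonormal frame of `V^⊥` over `U`, with `e₀`
time-like. -/
structure IsEnvelopeFrame (ξ : M → ℙ ℂ (Fin (k + 6) → ℂ)) (U : Set M)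
    (e₀ : M → Fin (k + 6) → ℝ) (e : Fin (k + 1) → M → Fin (k + 6) → ℝ) : Prop where
  smooth_zero : ContMDiffOn 𝓘(ℝ, ℂ) 𝓘(ℝ, Fin (k + 6) → ℝ) ∞ e₀ U
  smooth : ∀ j, ContMDiffOn 𝓘(ℝ, ℂ) 𝓘(ℝ, Fin (k + 6) → ℝ) ∞ (e j) U
  timelike : ∀ q ∈ U, lorentz (e₀ q) (e₀ q) = -1
  orthogonal : ∀ q ∈ U, ∀ j, lorentz (e₀ q) (e j q) = 0
  orthonormal : ∀ q ∈ U, ∀ i j, lorentz (e i q) (e j q) = if i = j then 1 else 0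
  span_eq : ∀ q ∈ U,
    Submodule.span ℝ (insert (e₀ q) (Set.range fun j => e j q)) = envelopeSpace ξ q

/-- The sphere `S^{m-2}`. -/
abbrev FiberSphere (k : ℕ) : Type := Metric.sphere (0 : EuclideanSpace ℝ (Fin (k + 1))) 1

/-- The light-like vector `Ŷ(q, Θ) = e₀(q) + ∑ Θ_j e_j(q)`. -/
def envelopeLift (e₀ : M → Fin (k + 6) → ℝ) (e : Fin (k + 1) → M → Fin (k + 6) → ℝ)
    (p : M × FiberSphere k) : Fin (k + 6) → ℝ :=
  e₀ p.1 + ∑ j, (p.2 : EuclideanSpace ℝ (Fin (k + 1))) j • e j p.1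

/-- The point `x` of `S^{m+2}` with `[(1, x)] = [Ŷ(q, Θ)]`. -/
def envelopeMap (e₀ : M → Fin (k + 6) → ℝ) (e : Fin (k + 1) → M → Fin (k + 6) → ℝ)
    (p : M × FiberSphere k) : EuclideanSpace ℝ (Fin (k + 5)) :=
  WithLp.toLp 2 fun i => envelopeLift e₀ e p i.succ / envelopeLift e₀ e p 0

end Curve

/-! ### Submanifolds of the unit sphere

`f` maps a manifold `N` (without boundary) into the unit sphere `S^{m+2}`. -/

section Submanifold

variable {k : ℕ} {E : Type*} [NormedAddCommGroup E] [NormedSpace ℝ E]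
  {H : Type*} [TopologicalSpace H] (I : ModelWithCorners ℝ E H)
  {N : Type*} [TopologicalSpace N] [ChartedSpace H N]
  (f : N → EuclideanSpace ℝ (Fin (k + 5))) (p : N)

/-- The differential of `f` at `p`. -/
def differential : TangentSpace I p →L[ℝ] EuclideanSpace ℝ (Fin (k + 5)) :=
  mfderiv I 𝓘(ℝ, EuclideanSpace ℝ (Fin (k + 5))) f p

/-- `f` is immersed at `p`. -/
def IsImmersedAt : Prop := Function.Injective (differential I f p)

/-- The normal space of `f` at `p` in the unit sphere. -/
def normalSpace : Submodule ℝ (EuclideanSpace ℝ (Fin (k + 5))) :=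
  (Submodule.span ℝ {f p} ⊔ LinearMap.range (differential I f p).toLinearMap)ᗮ

/-- The second derivative of `f` in the chart at `p`. -/
def hessian (u v : TangentSpace I p) : EuclideanSpace ℝ (Fin (k + 5)) :=
  fderiv ℝ (fderiv ℝ (f ∘ (extChartAt I p).symm)) (extChartAt I p p) u v

/-- The second fundamental form of `f` in the unit sphere: the normal part of the second
derivative (which does not depend on the chart). -/
def secondFundamentalForm (u v : TangentSpace I p) : EuclideanSpace ℝ (Fin (k + 5)) :=
  (normalSpace I f p).starProjection (hessian I f p u v)

/-- An orthonormal basis of the tangent space for the metric induced by `f`. -/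
def IsTangentFrame (u : Fin (k + 2) → TangentSpace I p) : Prop :=
  Orthonormal ℝ (fun i => differential I f p (u i)) ∧
    Submodule.span ℝ (Set.range u) = ⊤

/-- An orthonormal basis of the normal space. -/
def IsNormalFrame (n₁ n₂ : EuclideanSpace ℝ (Fin (k + 5))) : Prop :=
  Orthonormal ℝ ![n₁, n₂] ∧ Submodule.span ℝ {n₁, n₂} = normalSpace I f p

/-- The matrix of the shape operator `A_n` in the tangent frame `u`:
`⟨A_n u_i, u_j⟩ = ⟨II(u_i, u_j), n⟩`. -/
def shapeMatrix (u : Fin (k + 2) → TangentSpace I p) (n : EuclideanSpace ℝ (Fin (k + 5))) :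
    Matrix (Fin (k + 2)) (Fin (k + 2)) ℝ :=
  Matrix.of fun i j => inner ℝ (secondFundamentalForm I f p (u i) (u j)) n

/-- Wintgen ideal at `p`: in suitable orthonormal tangent and normal frames the shape operators
are `A_{n₁} = λ₁ Id + μ₀ (E₁₂ + E₂₁)` and `A_{n₂} = λ₂ Id + μ₀ (E₁₁ - E₂₂)`. -/
def IsWintgenIdealAt : Prop :=
  ∃ (u : Fin (k + 2) → TangentSpace I p) (n₁ n₂ : EuclideanSpace ℝ (Fin (k + 5)))
    (l₁ l₂ μ₀ : ℝ), IsTangentFrame I f p u ∧ IsNormalFrame I f p n₁ n₂ ∧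
    shapeMatrix I f p u n₁ =
      l₁ • (1 : Matrix (Fin (k + 2)) (Fin (k + 2)) ℝ) +
        μ₀ • (Matrix.single 0 1 (1 : ℝ) + Matrix.single 1 0 (1 : ℝ)) ∧
    shapeMatrix I f p u n₂ =
      l₂ • (1 : Matrix (Fin (k + 2)) (Fin (k + 2)) ℝ) +
        μ₀ • (Matrix.single 0 0 (1 : ℝ) - Matrix.single 1 1 (1 : ℝ))

/-- `h` is the mean curvature vector `(1/m) tr II` of `f` at `p`. -/
def IsMeanCurvatureVector (h : EuclideanSpace ℝ (Fin (k + 5))) : Prop :=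
  ∃ u : Fin (k + 2) → TangentSpace I p, IsTangentFrame I f p u ∧
    h = ((k : ℝ) + 2)⁻¹ • ∑ i, secondFundamentalForm I f p (u i) (u i)

/-- The vector `ξ_n = (h·n, n + (h·n) x)` of the hypersphere through `x` with normal `n` and
mean curvature `h·n`. -/
def sphereVector (x h n : EuclideanSpace ℝ (Fin (k + 5))) : Fin (k + 6) → ℝ :=
  pair (inner ℝ h n) (n + (inner ℝ h n : ℝ) • x)

/-- `P = [ξ₁ - i ξ₂]` represents the mean curvature sphere of `f` at `p`, where
`ξ_r = (H^r, n_r + H^r x)` for an orthonormal normal frame `n₁, n₂`. -/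
def HasMeanCurvatureSphere (P : ℙ ℂ (Fin (k + 6) → ℂ)) : Prop :=
  ∃ h n₁ n₂ : EuclideanSpace ℝ (Fin (k + 5)), IsMeanCurvatureVector I f p h ∧
    IsNormalFrame I f p n₁ n₂ ∧
    ∃ hne : toC (sphereVector (f p) h n₁) - Complex.I • toC (sphereVector (f p) h n₂) ≠ 0,
      P = Projectivization.mk ℂ _ hne

end Submanifold

end Wintgen

end

namespace Wintgen

/-! ### Shape operators and the mean curvature sphere -/

/-! Near a point of the envelope, write w for the parameter of the curve as a complex function on
the submanifold, ζ = ξ₁ - iξ₂ for a lift and η for its complex derivative, so that ⟨(1, x), ζ⟩ =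
⟨(1, x), η⟩ = 0. Differentiating the first relation gives ⟨(0, dx), ζ⟩ = 0, because the term in dw
carries the factor ⟨(1, x), η⟩. Once ⟨ζ, conj ζ⟩ = 2, removing the x-components from the space parts
of ξ₁, ξ₂ therefore leaves a normal frame n₁, n₂. Differentiating again gives, up to a real
constant, ⟨(0, d²x(u, v)), ζ⟩ = -dw(u) β(v) with β(v) = ⟨(0, dx(v)), η⟩. The left side is symmetric,
so the right side is a constant multiple of β(u) β(v).

Isotropy enters at this point. Since ⟨ζ, η⟩ = 0, the normal part of η is a multiple of n₁ - i n₂,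
hence isotropic; ⟨η, η⟩ = 0 then says that the tangential part of η has orthogonal real and
imaginary parts of equal length. Modulo umbilic terms the complex second fundamental form is thus
the square of an isotropic 1-form, which is the Wintgen normal form. It is trace-free, so the
umbilic terms, which are the time components of ξ₁, ξ₂, are the components of the mean curvature
vector, and [ζ] is the mean curvature sphere. The pointwise algebra is
`isWintgenIdealAt_of_normalized`; the differentiation is `isWintgenIdealAt_of_mem_envelope`.

Independence of the lift rests on `IsHolomorphicLift.gauge`. For the frames, where the differential
is positive the real and imaginary parts of the lift and of its horizontal derivative are four
orthogonal space-like vectors spanning V; they are completed by Gram–Schmidt. As V^⊥ is Lorentzian,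
its null lines are parametrized by a sphere, which gives the bijection with the envelope. -/

theorem exists_orthonormalBasis_smul_eq {k : ℕ} {F : Type*} [NormedAddCommGroup F]
    [InnerProductSpace ℝ F] [FiniteDimensional ℝ F] (hF : Module.finrank ℝ F = k + 2)
    {g₁ g₂ : F} (hg : ‖g₁‖ = ‖g₂‖) (hg₁₂ : inner ℝ g₁ g₂ = 0) :
    ∃ b : OrthonormalBasis (Fin (k + 2)) ℝ F, g₁ = ‖g₁‖ • b 0 ∧ g₂ = ‖g₁‖ • b 1 := by
  have hcard : Module.finrank ℝ F = Fintype.card (Fin (k + 2)) := by simp [hF]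
  rcases eq_or_ne g₁ 0 with h0 | h0
  -- The umbilic case: both vectors vanish and any orthonormal basis serves.
  · have h2 : g₂ = 0 := by
      rw [← norm_eq_zero, ← hg, h0, norm_zero]
    exact ⟨(stdOrthonormalBasis ℝ F).reindex (finCongr hF), by simp [h0], by simp [h0, h2]⟩
  · have hn : ‖g₁‖ ≠ 0 := norm_ne_zero_iff.mpr h0
    -- Only the values at 0 and 1 matter, since the family is restricted to these indices before
    -- being extended.
    let v : Fin (k + 2) → F := fun i => if i = 0 then ‖g₁‖⁻¹ • g₁ else ‖g₁‖⁻¹ • g₂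
    have hv : Orthonormal ℝ (({0, 1} : Set (Fin (k + 2))).domRestrict v) := by
      constructor
      · rintro ⟨i, hi⟩
        rcases hi with rfl | rfl
        · simp [v, Set.domRestrict, norm_smul, hn]
        · simp [v, Set.domRestrict, norm_smul, ← hg, hn]
      · rintro ⟨i, hi⟩ ⟨j, hj⟩ hij
        rcases hi with rfl | rfl <;> rcases hj with rfl | rfl
        · exact absurd rfl hij
        · simp [v, Set.domRestrict, inner_smul_left, inner_smul_right, hg₁₂]
        · simp [v, Set.domRestrict, inner_smul_left, inner_smul_right, real_inner_comm, hg₁₂]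
        · exact absurd rfl hij
    obtain ⟨b, hb⟩ := hv.exists_orthonormalBasis_extension_of_card_eq hcard
    refine ⟨b, ?_, ?_⟩
    · rw [hb 0 (by simp)]; simp [v, smul_smul, hn]
    · rw [hb 1 (by simp)]; simp [v, smul_smul, hn]

theorem offDiagonal_apply {k : ℕ} (a g : ℝ) (i j : Fin (k + 2)) :
    (a • (1 : Matrix (Fin (k + 2)) (Fin (k + 2)) ℝ) +
      g ^ 2 • (Matrix.single 0 1 (1 : ℝ) + Matrix.single 1 0 (1 : ℝ)) :
      Matrix (Fin (k + 2)) (Fin (k + 2)) ℝ) i j =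
    a * (if i = j then 1 else 0) + ((if 0 = i then g else 0) * (if 1 = j then g else 0) +
      (if 1 = i then g else 0) * (if 0 = j then g else 0)) := by
  simp only [Matrix.add_apply, Matrix.smul_apply, Matrix.one_apply, Matrix.single_apply,
    smul_eq_mul, ite_and, sq, mul_ite, ite_mul, mul_zero, zero_mul, mul_one, mul_add]
  split_ifs <;> rfl

theorem diagonal_apply {k : ℕ} (a g : ℝ) (i j : Fin (k + 2)) :
    (a • (1 : Matrix (Fin (k + 2)) (Fin (k + 2)) ℝ) +
      g ^ 2 • (Matrix.single 0 0 (1 : ℝ) - Matrix.single 1 1 (1 : ℝ)) :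
      Matrix (Fin (k + 2)) (Fin (k + 2)) ℝ) i j =
    a * (if i = j then 1 else 0) + ((if 0 = i then g else 0) * (if 0 = j then g else 0) -
      (if 1 = i then g else 0) * (if 1 = j then g else 0)) := by
  simp only [Matrix.add_apply, Matrix.smul_apply, Matrix.one_apply, Matrix.single_apply,
    Matrix.sub_apply,
    smul_eq_mul, ite_and, sq, mul_ite, ite_mul, mul_zero, zero_mul, mul_one, mul_sub]
  split_ifs <;> rfl

section Submanifold

variable {k : ℕ} {E : Type*} [NormedAddCommGroup E] [NormedSpace ℝ E]
  {H : Type*} [TopologicalSpace H] {I : ModelWithCorners ℝ E H}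
  {N : Type*} [TopologicalSpace N] [ChartedSpace H N]
  {f : N → EuclideanSpace ℝ (Fin (k + 5))} {p : N}

theorem inner_secondFundamentalForm {n : EuclideanSpace ℝ (Fin (k + 5))}
    (hn : n ∈ normalSpace I f p) (u v : TangentSpace I p) :
    inner ℝ (secondFundamentalForm I f p u v) n = inner ℝ (hessian I f p u v) n := by
  rw [secondFundamentalForm, Submodule.inner_starProjection_left_eq_right,
    Submodule.starProjection_eq_self_iff.mpr hn]

/-- With γ(u) = ⟨dx u, g₁⟩ + i⟨dx u, g₂⟩, the assumptions say that the non-umbilic parts along n₁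
and n₂ are the imaginary and real parts of γ(u) γ(v). In a tangent frame that starts along g₁, g₂
they become the two model matrices, with μ₀ the common squared length. Both are trace-free, which
leaves a₁, a₂ as mean curvature components. -/
theorem isWintgenIdealAt_of_hessian [FiniteDimensional ℝ E]
    (hE : Module.finrank ℝ E = k + 2) (hf : IsImmersedAt I f p)
    {n₁ n₂ g₁ g₂ : EuclideanSpace ℝ (Fin (k + 5))} {a₁ a₂ : ℝ} (hn : IsNormalFrame I f p n₁ n₂)
    (hg₁ : g₁ ∈ LinearMap.range (differential I f p).toLinearMap)
    (hg₂ : g₂ ∈ LinearMap.range (differential I f p).toLinearMap)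
    (hg : ‖g₁‖ = ‖g₂‖) (hg₁₂ : inner ℝ g₁ g₂ = 0)
    (h₁ : ∀ u v, inner ℝ (hessian I f p u v) n₁ =
      a₁ * inner ℝ (differential I f p u) (differential I f p v) +
        (inner ℝ (differential I f p u) g₁ * inner ℝ (differential I f p v) g₂ +
          inner ℝ (differential I f p u) g₂ * inner ℝ (differential I f p v) g₁))
    (h₂ : ∀ u v, inner ℝ (hessian I f p u v) n₂ =
      a₂ * inner ℝ (differential I f p u) (differential I f p v) +
        (inner ℝ (differential I f p u) g₁ * inner ℝ (differential I f p v) g₁ -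
          inner ℝ (differential I f p u) g₂ * inner ℝ (differential I f p v) g₂)) :
    IsWintgenIdealAt I f p ∧ ∃ h, IsMeanCurvatureVector I f p h ∧
      inner ℝ h n₁ = a₁ ∧ inner ℝ h n₂ = a₂ := by
  set T := differential I f p with hT
  have : FiniteDimensional ℝ (TangentSpace I p) := ‹FiniteDimensional ℝ E›
  have hinj : Function.Injective T.toLinearMap := hf
  let e : TangentSpace I p ≃ₗ[ℝ] LinearMap.range T.toLinearMap :=
    LinearEquiv.ofInjective T.toLinearMap hinj
  have hfin : Module.finrank ℝ (LinearMap.range T.toLinearMap) = k + 2 := by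
    rw [← e.finrank_eq]; exact hE
  obtain ⟨b, hb₁, hb₂⟩ := exists_orthonormalBasis_smul_eq hfin
    (g₁ := ⟨g₁, hg₁⟩) (g₂ := ⟨g₂, hg₂⟩) hg hg₁₂
  set g := ‖(⟨g₁, hg₁⟩ : LinearMap.range T.toLinearMap)‖
  let u : Fin (k + 2) → TangentSpace I p := fun i => e.symm (b i)
  have hTu : ∀ i, T (u i) = b i := fun i => by
    have : e (u i) = b i := e.apply_symm_apply _
    rw [← this]; rfl
  have hbb : ∀ i j, inner ℝ (b i : EuclideanSpace ℝ (Fin (k + 5))) (b j) =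
      if i = j then (1 : ℝ) else 0 := fun i j => by
    rw [← Submodule.coe_inner]; exact orthonormal_iff_ite.mp b.orthonormal i j
  have hbg₁ : ∀ i, inner ℝ (b i : EuclideanSpace ℝ (Fin (k + 5))) g₁ =
      if 0 = i then g else 0 := fun i => by
    have : g₁ = g • (b 0 : EuclideanSpace ℝ (Fin (k + 5))) := congrArg Subtype.val hb₁
    rw [this, inner_smul_right, hbb]; simp [eq_comm]
  have hbg₂ : ∀ i, inner ℝ (b i : EuclideanSpace ℝ (Fin (k + 5))) g₂ =
      if 1 = i then g else 0 := fun i => by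
    have : g₂ = g • (b 1 : EuclideanSpace ℝ (Fin (k + 5))) := congrArg Subtype.val hb₂
    rw [this, inner_smul_right, hbb]; simp [eq_comm]
  have hframe : IsTangentFrame I f p u := by
    refine ⟨?_, ?_⟩
    · rw [orthonormal_iff_ite]
      intro i j
      rw [← hT, hTu, hTu, hbb]
    · have : u = e.symm ∘ b := rfl
      rw [this, Set.range_comp, ← LinearEquiv.coe_coe, Submodule.span_image,
        ← OrthonormalBasis.coe_toBasis, b.toBasis.span_eq]
      simp
  have hn₁ : n₁ ∈ normalSpace I f p := hn.2 ▸ Submodule.subset_span (by simp)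
  have hn₂ : n₂ ∈ normalSpace I f p := hn.2 ▸ Submodule.subset_span (by simp)
  have hs₁ : ∀ i j, inner ℝ (secondFundamentalForm I f p (u i) (u j)) n₁ =
      a₁ * (if i = j then 1 else 0) + ((if 0 = i then g else 0) * (if 1 = j then g else 0) +
        (if 1 = i then g else 0) * (if 0 = j then g else 0)) := fun i j => by
    rw [inner_secondFundamentalForm hn₁, h₁, hTu, hTu, hbb, hbg₁, hbg₁, hbg₂, hbg₂]
  have hs₂ : ∀ i j, inner ℝ (secondFundamentalForm I f p (u i) (u j)) n₂ =
      a₂ * (if i = j then 1 else 0) + ((if 0 = i then g else 0) * (if 0 = j then g else 0) -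
        (if 1 = i then g else 0) * (if 1 = j then g else 0)) := fun i j => by
    rw [inner_secondFundamentalForm hn₂, h₂, hTu, hTu, hbb, hbg₁, hbg₁, hbg₂, hbg₂]
  have hk : (k : ℝ) + 2 ≠ 0 := by positivity
  refine ⟨⟨u, n₁, n₂, a₁, a₂, g ^ 2, hframe, hn, ?_, ?_⟩, _, ⟨u, hframe, rfl⟩, ?_, ?_⟩
  · ext i j
    rw [shapeMatrix, Matrix.of_apply, hs₁, offDiagonal_apply]
  · ext i j
    rw [shapeMatrix, Matrix.of_apply, hs₂, diagonal_apply]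
  · rw [inner_smul_left, sum_inner]
    simp only [hs₁, Finset.sum_add_distrib]
    simp
    field_simp
  · rw [inner_smul_left, sum_inner]
    simp only [hs₂, Finset.sum_add_distrib, Finset.sum_sub_distrib]
    simp
    field_simp

end Submanifold

/-! ### The Lorentz product -/

section Lorentz

variable {R : Type*} [CommRing R] {n : ℕ}

theorem lorentz_comm (Y Z : Fin (n + 1) → R) : lorentz Y Z = lorentz Z Y := by
  simp only [lorentz, mul_comm]

theorem lorentz_add_right (Y Z W : Fin (n + 1) → R) :
    lorentz Y (Z + W) = lorentz Y Z + lorentz Y W := by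
  simp only [lorentz, Pi.add_apply, mul_add, Finset.sum_add_distrib]
  ring

theorem lorentz_smul_right (c : R) (Y Z : Fin (n + 1) → R) :
    lorentz Y (c • Z) = c * lorentz Y Z := by
  simp only [lorentz, Pi.smul_apply, smul_eq_mul, mul_add, Finset.mul_sum]
  congr 1
  · ring
  · exact Finset.sum_congr rfl fun i _ => by ring

/-- The Lorentz product as a bilinear form. -/
def lorentzForm (R : Type*) [CommRing R] (n : ℕ) : LinearMap.BilinForm R (Fin (n + 1) → R) :=
  LinearMap.mk₂ R lorentz
    (fun Y Z W => by simp only [lorentz_comm _ W, lorentz_add_right])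
    (fun c Y Z => by simp only [lorentz_comm _ Z, lorentz_smul_right, smul_eq_mul])
    (fun Y Z W => lorentz_add_right Y Z W)
    (fun c Y Z => lorentz_smul_right c Y Z)

theorem lorentz_add_left (Y Z W : Fin (n + 1) → R) :
    lorentz (Y + Z) W = lorentz Y W + lorentz Z W :=
  LinearMap.map_add₂ (lorentzForm R n) Y Z W

theorem lorentz_smul_left (c : R) (Y Z : Fin (n + 1) → R) :
    lorentz (c • Y) Z = c * lorentz Y Z :=
  LinearMap.map_smul₂ (lorentzForm R n) c Y Z

theorem lorentz_sub_right (Y Z W : Fin (n + 1) → R) :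
    lorentz Y (Z - W) = lorentz Y Z - lorentz Y W :=
  map_sub (lorentzForm R n Y) Z W

theorem lorentz_sub_left (Y Z W : Fin (n + 1) → R) :
    lorentz (Y - Z) W = lorentz Y W - lorentz Z W :=
  LinearMap.map_sub₂ (lorentzForm R n) Y Z W

theorem lorentz_zero_left (Y : Fin (n + 1) → R) : lorentz 0 Y = 0 :=
  LinearMap.map_zero₂ (lorentzForm R n) Y

theorem lorentz_sum_right {ι : Type*} (s : Finset ι) (Y : Fin (n + 1) → R)
    (Z : ι → Fin (n + 1) → R) : lorentz Y (∑ i ∈ s, Z i) = ∑ i ∈ s, lorentz Y (Z i) :=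
  map_sum (lorentzForm R n Y) Z s

theorem lorentz_sum_left {ι : Type*} (s : Finset ι) (Y : Fin (n + 1) → R)
    (Z : ι → Fin (n + 1) → R) : lorentz (∑ i ∈ s, Z i) Y = ∑ i ∈ s, lorentz (Z i) Y := by
  simp only [lorentz_comm _ Y, lorentz_sum_right]

end Lorentz

/-- The real part of the space-like component. -/
def reTail {n : ℕ} (Z : Fin (n + 1) → ℂ) : EuclideanSpace ℝ (Fin n) :=
  WithLp.toLp 2 fun i => (Z i.succ).re

/-- The imaginary part of the space-like component. -/
def imTail {n : ℕ} (Z : Fin (n + 1) → ℂ) : EuclideanSpace ℝ (Fin n) :=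
  WithLp.toLp 2 fun i => (Z i.succ).im

theorem re_lorentz {n : ℕ} (Y Z : Fin (n + 1) → ℂ) :
    (lorentz Y Z).re = -((Y 0).re * (Z 0).re - (Y 0).im * (Z 0).im) +
      (inner ℝ (reTail Y) (reTail Z) - inner ℝ (imTail Y) (imTail Z)) := by
  simp [lorentz, reTail, imTail, PiLp.inner_apply, mul_comm]

theorem im_lorentz {n : ℕ} (Y Z : Fin (n + 1) → ℂ) :
    (lorentz Y Z).im = -((Y 0).re * (Z 0).im + (Y 0).im * (Z 0).re) +
      (inner ℝ (reTail Y) (imTail Z) + inner ℝ (imTail Y) (reTail Z)) := by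
  simp [lorentz, reTail, imTail, PiLp.inner_apply, mul_comm, Finset.sum_add_distrib]

theorem reTail_toC_pair {n : ℕ} (t : ℝ) (v : EuclideanSpace ℝ (Fin n)) :
    reTail (toC (pair t v)) = v := by
  ext i; simp [reTail, toC, pair]

theorem imTail_toC_pair {n : ℕ} (t : ℝ) (v : EuclideanSpace ℝ (Fin n)) :
    imTail (toC (pair t v)) = 0 := by
  ext i; simp [imTail, toC]

theorem re_lorentz_pair {n : ℕ} (t : ℝ) (v : EuclideanSpace ℝ (Fin n)) (Z : Fin (n + 1) → ℂ) :
    (lorentz (toC (pair t v)) Z).re = -(t * (Z 0).re) + inner ℝ v (reTail Z) := by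
  rw [re_lorentz, reTail_toC_pair, imTail_toC_pair]
  simp [toC, pair]

theorem im_lorentz_pair {n : ℕ} (t : ℝ) (v : EuclideanSpace ℝ (Fin n)) (Z : Fin (n + 1) → ℂ) :
    (lorentz (toC (pair t v)) Z).im = -(t * (Z 0).im) + inner ℝ v (imTail Z) := by
  rw [im_lorentz, reTail_toC_pair, imTail_toC_pair]
  simp [toC, pair]

theorem reTail_star {n : ℕ} (Z : Fin (n + 1) → ℂ) : reTail (star Z) = reTail Z := by
  ext i; simp [reTail]

theorem imTail_star {n : ℕ} (Z : Fin (n + 1) → ℂ) : imTail (star Z) = -imTail Z := by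
  ext i; simp [imTail]

/-! ### The second order condition at a point of an envelope -/

/-- Symmetry makes c proportional to β unless β vanishes, and a complex square root absorbs the
constant. The factor `Complex.I` fixes the phase so that the off-diagonal model matrix falls to n₁
and the diagonal one to n₂. -/
theorem exists_sq_of_symm {V : Type*} {β c : V → ℂ} (h : ∀ u v, c u * β v = c v * β u) :
    ∃ s : ℂ, ∀ u v, c u * β v = Complex.I * ((s * β u) * (s * β v)) := by
  by_cases h0 : ∀ u, β u = 0
  · exact ⟨0, fun u v => by simp [h0]⟩
  · push Not at h0
    obtain ⟨w, hw⟩ := h0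
    obtain ⟨s, hs⟩ := IsAlgClosed.exists_pow_nat_eq (c w / (Complex.I * β w)) (n := 2) (by norm_num)
    refine ⟨s, fun u v => ?_⟩
    have hI := Complex.I_ne_zero
    have : Complex.I * ((s * β u) * (s * β v)) = Complex.I * s ^ 2 * β u * β v := by ring
    rw [this, hs]
    have h2 : c w * β u = c u * β w := h w u
    field_simp
    linear_combination -β v * h2

section Pointwise

variable {k : ℕ} {E : Type*} [NormedAddCommGroup E] [NormedSpace ℝ E]
  {H : Type*} [TopologicalSpace H] {I : ModelWithCorners ℝ E H}
  {N : Type*} [TopologicalSpace N] [ChartedSpace H N]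
  {f : N → EuclideanSpace ℝ (Fin (k + 5))} {p : N}

/-- A dimension count: position vector and tangent space take up 1 + (k + 2) of k + 5 dimensions, so
two orthonormal normal vectors span the rest. -/
theorem isNormalFrame_of_orthonormal [FiniteDimensional ℝ E] (hE : Module.finrank ℝ E = k + 2)
    (hf : IsImmersedAt I f p) (hx : ‖f p‖ = 1)
    (hxT : ∀ u, inner ℝ (f p) (differential I f p u) = 0)
    {n₁ n₂ : EuclideanSpace ℝ (Fin (k + 5))} (hn : Orthonormal ℝ ![n₁, n₂])
    (hxn₁ : inner ℝ (f p) n₁ = 0) (hxn₂ : inner ℝ (f p) n₂ = 0)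
    (hTn₁ : ∀ u, inner ℝ (differential I f p u) n₁ = 0)
    (hTn₂ : ∀ u, inner ℝ (differential I f p u) n₂ = 0) : IsNormalFrame I f p n₁ n₂ := by
  refine ⟨hn, ?_⟩
  have : FiniteDimensional ℝ (TangentSpace I p) := ‹FiniteDimensional ℝ E›
  set T := differential I f p with hT
  have hx0 : f p ≠ 0 := by rw [← norm_ne_zero_iff, hx]; norm_num
  have hort : (Submodule.span ℝ {f p}) ⟂ (LinearMap.range T.toLinearMap) := by
    rw [Submodule.isOrtho_iff_inner_eq]
    rintro a ha b ⟨u, rfl⟩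
    obtain ⟨t, rfl⟩ := Submodule.mem_span_singleton.mp ha
    rw [inner_smul_left]
    exact mul_eq_zero_of_right _ (hxT u)
  have hrange : Module.finrank ℝ (LinearMap.range T.toLinearMap) = k + 2 := by
    rw [LinearMap.finrank_range_of_inj hf]; exact hE
  have hsup : Module.finrank ℝ
      (Submodule.span ℝ {f p} ⊔ LinearMap.range T.toLinearMap : Submodule ℝ _) = k + 3 := by
    have h := Submodule.finrank_sup_add_finrank_inf_eq (Submodule.span ℝ {f p})
      (LinearMap.range T.toLinearMap)
    rw [hort.disjoint.eq_bot, finrank_bot, finrank_span_singleton hx0, hrange] at h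
    omega
  have hnorm : Module.finrank ℝ (normalSpace I f p) = 2 := by
    have h := Submodule.finrank_add_finrank_orthogonal
      (Submodule.span ℝ {f p} ⊔ LinearMap.range T.toLinearMap)
    rw [hsup, finrank_euclideanSpace_fin] at h
    rw [normalSpace, ← hT]
    omega
  have hspan : Module.finrank ℝ (Submodule.span ℝ {n₁, n₂}) = 2 := by
    have h := finrank_span_eq_card hn.linearIndependent
    rwa [Matrix.range_cons, Matrix.range_cons, Matrix.range_empty, Set.union_empty,
      Set.singleton_union, Fintype.card_fin] at h
  refine Submodule.eq_of_le_of_finrank_eq ?_ (by rw [hspan, hnorm])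
  have key : ∀ n, inner ℝ (f p) n = 0 → (∀ u, inner ℝ (T u) n = 0) → n ∈ normalSpace I f p := by
    intro n h1 h2
    rw [normalSpace, ← Submodule.inf_orthogonal, Submodule.mem_inf,
      Submodule.mem_orthogonal_singleton_iff_inner_right]
    refine ⟨h1, ?_⟩
    rw [Submodule.mem_orthogonal]
    rintro _ ⟨u, rfl⟩
    exact h2 u
  rw [Submodule.span_le]
  rintro n (rfl | rfl)
  · exact key _ hxn₁ hTn₁
  · exact key _ hxn₂ hTn₂

theorem mem_range_differential {n₁ n₂ v : EuclideanSpace ℝ (Fin (k + 5))}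
    (hn : IsNormalFrame I f p n₁ n₂) (hx : ‖f p‖ = 1)
    (hxT : ∀ u, inner ℝ (f p) (differential I f p u) = 0)
    (hxv : inner ℝ (f p) v = 0) (h₁ : inner ℝ n₁ v = 0) (h₂ : inner ℝ n₂ v = 0) :
    v ∈ LinearMap.range (differential I f p).toLinearMap := by
  have hv : v ∈ (normalSpace I f p)ᗮ := by
    rw [← hn.2, Submodule.mem_orthogonal]
    intro w hw
    obtain ⟨a, b, rfl⟩ := Submodule.mem_span_pair.mp hw
    rw [inner_add_left, inner_smul_left, inner_smul_left, h₁, h₂]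
    simp
  rw [normalSpace, Submodule.orthogonal_orthogonal] at hv
  obtain ⟨a, ha, b, hb, rfl⟩ := Submodule.mem_sup.mp hv
  obtain ⟨t, rfl⟩ := Submodule.mem_span_singleton.mp ha
  obtain ⟨u, rfl⟩ := hb
  have ht : t = 0 := by
    have : inner ℝ (f p) ((differential I f p).toLinearMap u) = 0 := hxT u
    rw [inner_add_right, inner_smul_right, this, real_inner_self_eq_norm_sq, hx] at hxv
    simpa using hxv
  rw [ht, zero_smul, zero_add]
  exact ⟨u, rfl⟩

/-- The algebraic core, at a single point and without the curve: `η` stands for the derivative of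
the lift and `c` for the differential of the parameter, up to scale. Beyond the differentiated
incidence relations, the curve contributes only that `ζ` and `η` span a totally isotropic subspace.
-/
theorem isWintgenIdealAt_of_normalized [FiniteDimensional ℝ E] (hE : Module.finrank ℝ E = k + 2)
    (hf : IsImmersedAt I f p) (hx : ‖f p‖ = 1)
    (hxT : ∀ u, inner ℝ (f p) (differential I f p u) = 0)
    (hxB : ∀ u v, inner ℝ (hessian I f p u v) (f p) =
      -inner ℝ (differential I f p u) (differential I f p v))
    (hB : ∀ u v, hessian I f p u v = hessian I f p v u)
    {ζ η : Fin (k + 6) → ℂ} {c : TangentSpace I p → ℂ}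
    (hζx : lorentz (toC (pair 1 (f p))) ζ = 0) (hηx : lorentz (toC (pair 1 (f p))) η = 0)
    (hζT : ∀ u, lorentz (toC (pair 0 (differential I f p u))) ζ = 0)
    (hζB : ∀ u v, lorentz (toC (pair 0 (hessian I f p u v))) ζ +
      c u * lorentz (toC (pair 0 (differential I f p v))) η = 0)
    (hζζ : lorentz ζ ζ = 0) (hζη : lorentz ζ η = 0) (hηη : lorentz η η = 0)
    (hζ : (lorentz ζ (star ζ)).re = 2) (hζ0 : ζ ≠ 0) :
    IsWintgenIdealAt I f p ∧ HasMeanCurvatureSphere I f p (Projectivization.mk ℂ ζ hζ0) := by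
  set T := differential I f p with hT
  set x := f p with hxdef
  -- Since ζ = ξ₁ - iξ₂, the data a₂, w₂ of ξ₂ are minus imaginary parts, whereas η is split below
  -- as v₁ + i v₂.
  set a₁ := (ζ 0).re with ha₁
  set a₂ := -(ζ 0).im with ha₂
  set w₁ := reTail ζ with hw₁
  set w₂ := -imTail ζ with hw₂
  have hi0 : (ζ 0).im = -a₂ := by rw [ha₂, neg_neg]
  have hiT : imTail ζ = -w₂ := by rw [hw₂, neg_neg]
  set b₁ := (η 0).re with hb₁
  set b₂ := (η 0).im with hb₂
  set v₁ := reTail η with hv₁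
  set v₂ := imTail η with hv₂
  have hxx : inner ℝ x x = 1 := by rw [real_inner_self_eq_norm_sq, hx]; norm_num
  have hxw₁ : inner ℝ x w₁ = a₁ := by
    have := congrArg Complex.re hζx
    rw [re_lorentz_pair, Complex.zero_re] at this; linarith
  have hxw₂ : inner ℝ x w₂ = a₂ := by
    have := congrArg Complex.im hζx
    rw [im_lorentz_pair, hiT, hi0, inner_neg_right, Complex.zero_im] at this; linarith
  have hxv₁ : inner ℝ x v₁ = b₁ := by
    have := congrArg Complex.re hηx
    rw [re_lorentz_pair, Complex.zero_re] at this; linarith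
  have hxv₂ : inner ℝ x v₂ = b₂ := by
    have := congrArg Complex.im hηx
    rw [im_lorentz_pair, Complex.zero_im] at this; linarith
  have hTw₁ : ∀ u, inner ℝ (T u) w₁ = 0 := fun u => by
    have := congrArg Complex.re (hζT u)
    rw [re_lorentz_pair, Complex.zero_re] at this; linarith
  have hTw₂ : ∀ u, inner ℝ (T u) w₂ = 0 := fun u => by
    have := congrArg Complex.im (hζT u)
    rw [im_lorentz_pair, hiT, inner_neg_right, Complex.zero_im] at this; linarith
  have hTx : ∀ u, inner ℝ (T u) x = 0 := fun u => by rw [real_inner_comm]; exact hxT u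
  have hζζ₁ := congrArg Complex.re hζζ
  have hζζ₂ := congrArg Complex.im hζζ
  have hζη₁ := congrArg Complex.re hζη
  have hζη₂ := congrArg Complex.im hζη
  have hηη₁ := congrArg Complex.re hηη
  have hηη₂ := congrArg Complex.im hηη
  rw [re_lorentz, Complex.zero_re] at hζζ₁ hζη₁ hηη₁
  rw [im_lorentz, Complex.zero_im] at hζζ₂ hζη₂ hηη₂
  rw [re_lorentz, reTail_star, imTail_star, Pi.star_apply, Complex.star_def, Complex.conj_re,
    Complex.conj_im] at hζ
  simp only [← ha₁, ← hw₁, ← hb₁, ← hb₂, ← hv₁, ← hv₂, hi0, hiT, inner_neg_left, inner_neg_right,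
    real_inner_comm w₁ w₂, real_inner_comm v₁ v₂] at hζζ₁ hζζ₂ hζη₁ hζη₂ hηη₁ hηη₂ hζ
  -- the normal frame
  set n₁ := w₁ - a₁ • x with hn₁
  set n₂ := w₂ - a₂ • x with hn₂
  have hxn₁ : inner ℝ x n₁ = 0 := by
    rw [hn₁, inner_sub_right, inner_smul_right, hxw₁, hxx]; ring
  have hxn₂ : inner ℝ x n₂ = 0 := by
    rw [hn₂, inner_sub_right, inner_smul_right, hxw₂, hxx]; ring
  have hTn₁ : ∀ u, inner ℝ (T u) n₁ = 0 := fun u => by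
    rw [hn₁, inner_sub_right, inner_smul_right, hTw₁, hTx]; ring
  have hTn₂ : ∀ u, inner ℝ (T u) n₂ = 0 := fun u => by
    rw [hn₂, inner_sub_right, inner_smul_right, hTw₂, hTx]; ring
  have hwn : ∀ (w : EuclideanSpace ℝ (Fin (k + 5))) (b a : ℝ)
      (w' : EuclideanSpace ℝ (Fin (k + 5))), inner ℝ x w' = b →
      inner ℝ (w - a • x) w' = inner ℝ w w' - a * b := fun w b a w' h => by
    rw [inner_sub_left, real_inner_smul_left, h]
  have hn₁₁ : inner ℝ n₁ n₁ = 1 := by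
    rw [hn₁, hwn w₁ 0 a₁ _ hxn₁, hn₁, inner_sub_right, inner_smul_right, real_inner_comm x w₁, hxw₁]
    linarith
  have hn₂₂ : inner ℝ n₂ n₂ = 1 := by
    rw [hn₂, hwn w₂ 0 a₂ _ hxn₂, hn₂, inner_sub_right, inner_smul_right, real_inner_comm x w₂, hxw₂]
    linarith
  have hn₁₂ : inner ℝ n₁ n₂ = 0 := by
    rw [hn₁, hwn w₁ 0 a₁ _ hxn₂, hn₂, inner_sub_right, inner_smul_right, real_inner_comm x,
      hxw₁]
    linarith
  have hn₂₁ : inner ℝ n₂ n₁ = 0 := by rw [real_inner_comm]; exact hn₁₂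
  have hn : Orthonormal ℝ ![n₁, n₂] := by
    rw [orthonormal_iff_ite]
    intro i j
    fin_cases i <;> fin_cases j
    · simpa using hn₁₁
    · simpa using hn₁₂
    · simpa using hn₂₁
    · simpa using hn₂₂
  have hframe := isNormalFrame_of_orthonormal hE hf hx hxT hn hxn₁ hxn₂ hTn₁ hTn₂
  -- the tangential part of `η`
  set N₁₁ := inner ℝ n₁ v₁ with hN₁₁
  set N₁₂ := inner ℝ n₁ v₂ with hN₁₂
  -- By ⟨ζ, η⟩ = 0 the normal part of η is (N₁₁ + i N₁₂)(n₁ - i n₂), which is isotropic.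
  have hN₂₂ : inner ℝ n₂ v₂ = -N₁₁ := by
    rw [hN₁₁, hn₁, hn₂, hwn _ _ _ _ hxv₁, hwn _ _ _ _ hxv₂]
    linarith
  have hN₂₁ : inner ℝ n₂ v₁ = N₁₂ := by
    rw [hN₁₂, hn₁, hn₂, hwn _ _ _ _ hxv₁, hwn _ _ _ _ hxv₂]
    linarith
  have hn₁x : inner ℝ n₁ x = 0 := by rw [real_inner_comm]; exact hxn₁
  have hn₂x : inner ℝ n₂ x = 0 := by rw [real_inner_comm]; exact hxn₂
  set p₁ := v₁ - b₁ • x - N₁₁ • n₁ - N₁₂ • n₂ with hp₁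
  set p₂ := v₂ - b₂ • x - N₁₂ • n₁ + N₁₁ • n₂ with hp₂
  have hxp₁ : inner ℝ x p₁ = 0 := by
    simp only [hp₁, inner_sub_right, inner_smul_right, hxx, hxn₁, hxn₂, hxv₁]; ring
  have hxp₂ : inner ℝ x p₂ = 0 := by
    simp only [hp₂, inner_sub_right, inner_add_right, inner_smul_right, hxx, hxn₁, hxn₂, hxv₂]
    ring
  have hn₁p₁ : inner ℝ n₁ p₁ = 0 := by
    simp only [hp₁, inner_sub_right, inner_smul_right, hn₁x, hn₁₁, hn₁₂, ← hN₁₁]; ring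
  have hn₂p₁ : inner ℝ n₂ p₁ = 0 := by
    simp only [hp₁, inner_sub_right, inner_smul_right, hn₂x, hn₂₁, hn₂₂, hN₂₁]; ring
  have hn₁p₂ : inner ℝ n₁ p₂ = 0 := by
    simp only [hp₂, inner_sub_right, inner_add_right, inner_smul_right, hn₁x, hn₁₁, hn₁₂, ← hN₁₂]
    ring
  have hn₂p₂ : inner ℝ n₂ p₂ = 0 := by
    simp only [hp₂, inner_sub_right, inner_add_right, inner_smul_right, hn₂x, hn₂₁, hn₂₂, hN₂₂]
    ring
  have hv₁p : v₁ = p₁ + b₁ • x + N₁₁ • n₁ + N₁₂ • n₂ := by rw [hp₁]; abel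
  have hv₂p : v₂ = p₂ + b₂ • x + N₁₂ • n₁ - N₁₁ • n₂ := by rw [hp₂]; abel
  have hp₁x : inner ℝ p₁ x = 0 := by rw [real_inner_comm]; exact hxp₁
  have hp₂x : inner ℝ p₂ x = 0 := by rw [real_inner_comm]; exact hxp₂
  have hp₁n₁ : inner ℝ p₁ n₁ = 0 := by rw [real_inner_comm]; exact hn₁p₁
  have hp₁n₂ : inner ℝ p₁ n₂ = 0 := by rw [real_inner_comm]; exact hn₂p₁
  have hp₂n₁ : inner ℝ p₂ n₁ = 0 := by rw [real_inner_comm]; exact hn₁p₂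
  have hp₂n₂ : inner ℝ p₂ n₂ = 0 := by rw [real_inner_comm]; exact hn₂p₂
  have hvv₁₁ : inner ℝ v₁ v₁ = inner ℝ p₁ p₁ + b₁ ^ 2 + N₁₁ ^ 2 + N₁₂ ^ 2 := by
    conv_lhs => rw [hv₁p]
    simp only [inner_add_left, inner_add_right, real_inner_smul_left, inner_smul_right, hxx, hn₁₁,
      hn₂₂, hn₁₂, hn₂₁, hn₁x, hn₂x, hxn₁, hxn₂, hp₁x, hxp₁, hp₁n₁, hp₁n₂, hn₁p₁, hn₂p₁]
    ring
  have hvv₂₂ : inner ℝ v₂ v₂ = inner ℝ p₂ p₂ + b₂ ^ 2 + N₁₂ ^ 2 + N₁₁ ^ 2 := by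
    conv_lhs => rw [hv₂p]
    simp only [inner_add_left, inner_add_right, inner_sub_left, inner_sub_right,
      real_inner_smul_left, inner_smul_right, hxx, hn₁₁,
      hn₂₂, hn₁₂, hn₂₁, hn₁x, hn₂x, hxn₁, hxn₂, hp₂x, hxp₂, hp₂n₁, hp₂n₂, hn₁p₂, hn₂p₂]
    ring
  have hvv₁₂ : inner ℝ v₁ v₂ = inner ℝ p₁ p₂ + b₁ * b₂ := by
    conv_lhs => rw [hv₁p, hv₂p]
    simp only [inner_add_left, inner_add_right, inner_sub_right,
      real_inner_smul_left, inner_smul_right, hxx, hn₁₁,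
      hn₂₂, hn₁₂, hn₂₁, hn₁x, hn₂x, hxn₁, hxn₂, hp₁x, hxp₂, hp₁n₁, hp₁n₂, hn₁p₂, hn₂p₂]
    ring
  -- In ⟨η, η⟩ the time component cancels the x-component and the normal part contributes nothing,
  -- so p₁ + i p₂ is isotropic.
  have hpp : inner ℝ p₁ p₁ = inner ℝ p₂ p₂ := by linarith
  have hp₁₂ : inner ℝ p₁ p₂ = 0 := by linarith
  have hp₂₁ : inner ℝ p₂ p₁ = 0 := by rw [real_inner_comm]; exact hp₁₂
  have hp₁T := mem_range_differential hframe hx hxT hxp₁ hn₁p₁ hn₂p₁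
  have hp₂T := mem_range_differential hframe hx hxT hxp₂ hn₁p₂ hn₂p₂
  -- the rank one structure
  set β : TangentSpace I p → ℂ := fun v => lorentz (toC (pair 0 (T v))) η with hβ
  have hβre : ∀ v, (β v).re = inner ℝ (T v) p₁ := fun v => by
    simp only [hβ, re_lorentz_pair, ← hv₁]
    rw [hv₁p]
    simp only [inner_add_right, inner_smul_right, hTx, hTn₁, hTn₂]; ring
  have hβim : ∀ v, (β v).im = inner ℝ (T v) p₂ := fun v => by
    simp only [hβ, im_lorentz_pair, ← hv₂]
    rw [hv₂p]
    simp only [inner_add_right, inner_sub_right, inner_smul_right, hTx, hTn₁, hTn₂]; ring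
  obtain ⟨s, hs⟩ := exists_sq_of_symm (β := β) (c := c) fun u v => by
    have h1 := hζB u v
    have h2 := hζB v u
    rw [hB v u] at h2
    exact add_left_cancel (h1.trans h2.symm)
  have hBζ : ∀ u v, lorentz (toC (pair 0 (hessian I f p u v))) ζ =
      -(Complex.I * ((s * β u) * (s * β v))) := fun u v => by
    rw [← hs]; exact eq_neg_of_add_eq_zero_left (hζB u v)
  -- g₁ + i g₂ = s (p₁ + i p₂), and scaling by a complex number preserves isotropy.
  set g₁ := s.re • p₁ - s.im • p₂ with hg₁
  set g₂ := s.re • p₂ + s.im • p₁ with hg₂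
  have hγ : ∀ u, s * β u = (inner ℝ (T u) g₁ : ℝ) + (inner ℝ (T u) g₂ : ℝ) * Complex.I :=
    fun u => by
      apply Complex.ext
      · simp [hg₁, hβre, hβim, inner_sub_right, inner_smul_right]
      · simp [hg₂, hβre, hβim, inner_add_right, inner_smul_right]
  have hBx : ∀ u v, inner ℝ (hessian I f p u v) x = -inner ℝ (T u) (T v) := hxB
  have hgg : inner ℝ g₁ g₁ = inner ℝ g₂ g₂ := by
    simp only [hg₁, hg₂, inner_add_left, inner_add_right, inner_sub_left, inner_sub_right,
      real_inner_smul_left, inner_smul_right, hpp, hp₁₂, hp₂₁]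
    ring
  have hg₁₂ : inner ℝ g₁ g₂ = 0 := by
    simp only [hg₁, hg₂, inner_add_right, inner_sub_left,
      real_inner_smul_left, inner_smul_right, hpp, hp₁₂, hp₂₁]
    ring
  have hgn : ‖g₁‖ = ‖g₂‖ := by
    rw [norm_eq_sqrt_real_inner, norm_eq_sqrt_real_inner, hgg]
  obtain ⟨hW, h, hh, hh₁, hh₂⟩ := isWintgenIdealAt_of_hessian (a₁ := a₁) (a₂ := a₂) hE hf hframe
    (g₁ := g₁) (g₂ := g₂)
    (sub_mem (Submodule.smul_mem _ _ hp₁T) (Submodule.smul_mem _ _ hp₂T))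
    (add_mem (Submodule.smul_mem _ _ hp₂T) (Submodule.smul_mem _ _ hp₁T)) hgn hg₁₂
    (fun u v => by
      have := congrArg Complex.re (hBζ u v)
      rw [re_lorentz_pair, hγ, hγ] at this
      simp at this
      rw [hn₁, inner_sub_right, inner_smul_right, hBx, hw₁, this]
      ring)
    (fun u v => by
      have := congrArg Complex.im (hBζ u v)
      rw [im_lorentz_pair, hγ, hγ] at this
      simp at this
      rw [hn₂, inner_sub_right, inner_smul_right, hBx, hw₂, inner_neg_right, this]
      ring)
  -- As h has components a₁, a₂, adding a_r x to n_r restores w_r, so the sphere vectors reassemble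
  -- ζ exactly.
  have hvec : toC (sphereVector (f p) h n₁) - Complex.I • toC (sphereVector (f p) h n₂) = ζ := by
    rw [sphereVector, sphereVector, hh₁, hh₂, hn₁, hn₂, sub_add_cancel, sub_add_cancel]
    funext i
    refine Fin.cases ?_ (fun j => ?_) i
    · apply Complex.ext <;> simp [toC, pair, ha₁, ha₂]
    · apply Complex.ext <;> simp [toC, pair, hw₁, hw₂, reTail, imTail]
  refine ⟨hW, h, n₁, n₂, hh, hframe, by rw [hvec]; exact hζ0, ?_⟩
  simp only [hvec]

end Pointwise

/-! ### Holomorphic lifts in a chart -/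

/-- The component of `W` orthogonal to `A` for the Hermitian product `⟨·, conj ·⟩`. -/
noncomputable def horizontalPart {n : ℕ} (A W : Fin (n + 1) → ℂ) : Fin (n + 1) → ℂ :=
  W - (lorentz W (star A) / lorentz A (star A)) • A

theorem re_lorentz_smul_star {n : ℕ} (a : ℂ) (A : Fin (n + 1) → ℂ) :
    (lorentz (a • A) (star (a • A))).re = Complex.normSq a * (lorentz A (star A)).re := by
  rw [star_smul, lorentz_smul_left, lorentz_smul_right, ← mul_assoc, Complex.star_def,
    Complex.mul_conj, Complex.re_ofReal_mul]

/-- A change of lift alters the derivative by a factor and by a multiple of the lift; the projection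
removes the latter, so positivity of the horizontal norm is independent of the lift. -/
theorem horizontalPart_gauge {n : ℕ} {a b : ℂ} {A W : Fin (n + 1) → ℂ} (ha : a ≠ 0)
    (hA : lorentz A (star A) ≠ 0) :
    horizontalPart (a • A) (a • W + b • A) = a • horizontalPart A W := by
  have ha' : star a ≠ 0 := star_ne_zero.mpr ha
  have key : (a * (star a * lorentz W (star A)) + b * (star a * lorentz A (star A))) /
      (a * (star a * lorentz A (star A))) * a =
      b + a * (lorentz W (star A) / lorentz A (star A)) := by
    field_simp
    ring
  rw [horizontalPart, horizontalPart, star_smul, lorentz_add_left, lorentz_smul_left,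
    lorentz_smul_left, lorentz_smul_left, lorentz_smul_right, lorentz_smul_right, smul_smul, key,
    smul_sub, smul_smul, add_smul]
  abel

theorem hasDerivAt_lorentz {𝕜 A : Type*} [NontriviallyNormedField 𝕜] [NormedCommRing A]
    [NormedAlgebra 𝕜 A] {n : ℕ} {Y Z : 𝕜 → Fin (n + 1) → A} {Y' Z' : Fin (n + 1) → A} {z : 𝕜}
    (hY : HasDerivAt Y Y' z) (hZ : HasDerivAt Z Z' z) :
    HasDerivAt (fun w => lorentz (Y w) (Z w)) (lorentz Y' (Z z) + lorentz (Y z) Z') z := by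
  have hY' := fun i => (hasDerivAt_pi.mp hY) i
  have hZ' := fun i => (hasDerivAt_pi.mp hZ) i
  have h := ((hY' 0).mul (hZ' 0)).neg.add
    (HasDerivAt.fun_sum fun (i : Fin n) (_ : i ∈ Finset.univ) => (hY' i.succ).mul (hZ' i.succ))
  refine h.congr_deriv ?_
  simp only [lorentz, Finset.sum_add_distrib]
  ring

section Curve

variable {k : ℕ} {M : Type*} [TopologicalSpace M] [ChartedSpace ℂ M]
  {ξ : M → ℙ ℂ (Fin (k + 6) → ℂ)} {U V : Set M} {ζ ζ' : M → Fin (k + 6) → ℂ} {q : M}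

theorem IsHolomorphicLift.exists_smul (h : IsHolomorphicLift ξ U ζ) (h' : IsHolomorphicLift ξ V ζ')
    (hq : q ∈ U) (hq' : q ∈ V) : ∃ a : ℂ, a ≠ 0 ∧ ζ' q = a • ζ q := by
  obtain ⟨h0, h1⟩ := h.lifts q hq
  obtain ⟨h0', h1'⟩ := h'.lifts q hq'
  rw [h1, Projectivization.mk_eq_mk_iff'] at h1'
  obtain ⟨a, ha⟩ := h1'
  have ha0 : a ≠ 0 := by rintro rfl; exact h0 (by rw [← ha, zero_smul])
  exact ⟨a⁻¹, inv_ne_zero ha0, by rw [← ha, smul_smul, inv_mul_cancel₀ ha0, one_smul]⟩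

theorem IsHolomorphicLift.null_and_pos (h : IsHolomorphicLift ξ U ζ)
    (hξ : IsOneIsotropicCurve ξ) (hq : q ∈ U) :
    lorentz (ζ q) (ζ q) = 0 ∧ 0 < (lorentz (ζ q) (star (ζ q))).re := by
  obtain ⟨h0, h1⟩ := h.lifts q hq
  obtain ⟨Z, hZ, hZξ, hZZ, hZp⟩ := hξ.mem_Qplus q
  rw [h1, Projectivization.mk_eq_mk_iff'] at hZξ
  obtain ⟨a, ha⟩ := hZξ
  rw [← ha]
  have ha0 : a ≠ 0 := by rintro rfl; exact h0 (by rw [← ha, zero_smul])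
  refine ⟨by rw [lorentz_smul_left, lorentz_smul_right, hZZ, mul_zero, mul_zero], ?_⟩
  rw [re_lorentz_smul_star]
  exact mul_pos (Complex.normSq_pos.mpr ha0) hZp

theorem IsHolomorphicLift.isOpen_chart (h : IsHolomorphicLift ξ U ζ) (q₀ : M) :
    IsOpen ((chartAt ℂ q₀).target ∩ (chartAt ℂ q₀).symm ⁻¹' U) :=
  (chartAt ℂ q₀).isOpen_inter_preimage_symm h.isOpen

variable [IsManifold 𝓘(ℂ) ω M]

theorem IsHolomorphicLift.differentiableOn_comp_chart_symm (h : IsHolomorphicLift ξ U ζ) (q₀ : M) :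
    DifferentiableOn ℂ (ζ ∘ (chartAt ℂ q₀).symm)
      ((chartAt ℂ q₀).target ∩ (chartAt ℂ q₀).symm ⁻¹' U) := by
  have : IsManifold 𝓘(ℂ) 1 M := .of_le (n := ω) le_top
  rw [← mdifferentiableOn_iff_differentiableOn]
  exact h.holomorphic.comp
    ((mdifferentiableOn_atlas_symm (chart_mem_atlas ℂ q₀)).mono Set.inter_subset_left)
    fun z hz => hz.2

theorem IsHolomorphicLift.hasDerivAt (h : IsHolomorphicLift ξ U ζ) {q₀ : M} (hq : q ∈ U)
    (hq₀ : q ∈ (chartAt ℂ q₀).source) :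
    HasDerivAt (ζ ∘ (chartAt ℂ q₀).symm)
      (deriv (ζ ∘ (chartAt ℂ q₀).symm) (chartAt ℂ q₀ q)) (chartAt ℂ q₀ q) := by
  refine ((h.differentiableOn_comp_chart_symm q₀).differentiableAt
    ((h.isOpen_chart q₀).mem_nhds ⟨(chartAt ℂ q₀).map_source hq₀, ?_⟩)).hasDerivAt
  rw [Set.mem_preimage, (chartAt ℂ q₀).left_inv hq₀]
  exact hq

theorem IsHolomorphicLift.dlift_eq (h : IsHolomorphicLift ξ U ζ) {q₀ : M} (hq : q ∈ U)
    (hq₀ : q ∈ (chartAt ℂ q₀).source) (v : TangentSpace 𝓘(ℂ) q) :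
    dlift ζ q v = (show ℂ from mfderiv 𝓘(ℂ) 𝓘(ℂ) (chartAt ℂ q₀) q v) •
      deriv (ζ ∘ (chartAt ℂ q₀).symm) (chartAt ℂ q₀ q) := by
  have : IsManifold 𝓘(ℂ) 1 M := .of_le (n := ω) le_top
  have h1 : HasMFDerivAt 𝓘(ℂ) 𝓘(ℂ) (chartAt ℂ q₀) q (mfderiv 𝓘(ℂ) 𝓘(ℂ) (chartAt ℂ q₀) q) :=
    (mdifferentiableAt_atlas (chart_mem_atlas ℂ q₀) hq₀).hasMFDerivAt
  have h2 := (h.hasDerivAt hq hq₀).hasFDerivAt.hasMFDerivAt.comp q h1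
  have h3 : (ζ ∘ (chartAt ℂ q₀).symm) ∘ (chartAt ℂ q₀) =ᶠ[nhds q] ζ := by
    filter_upwards [(chartAt ℂ q₀).open_source.mem_nhds hq₀] with x hx
    simp [(chartAt ℂ q₀).left_inv hx]
  rw [dlift, (h2.congr_of_eventuallyEq h3.symm).mfderiv]
  rfl

theorem exists_mfderiv_chart_eq_one {q₀ : M} (hq₀ : q ∈ (chartAt ℂ q₀).source) :
    ∃ v : TangentSpace 𝓘(ℂ) q, v ≠ 0 ∧
      (show ℂ from mfderiv 𝓘(ℂ) 𝓘(ℂ) (chartAt ℂ q₀) q v) = 1 := by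
  have : IsManifold 𝓘(ℂ) 1 M := .of_le (n := ω) le_top
  obtain ⟨v, hv⟩ := ((mdifferentiable_chart (I := 𝓘(ℂ)) q₀).mfderiv_surjective hq₀) (1 : ℂ)
  refine ⟨v, ?_, hv⟩
  rintro rfl
  rw [map_zero] at hv
  exact zero_ne_one (α := ℂ) hv

/-- The product rule for ζ' = aζ with a nonvanishing holomorphic factor, of which only the value and
the coefficient produced by its derivative are kept. Everything independent of the lift goes through
this. -/
theorem IsHolomorphicLift.gauge (h : IsHolomorphicLift ξ U ζ) (h' : IsHolomorphicLift ξ V ζ')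
    (hq : q ∈ U) (hq' : q ∈ V) : ∃ a : ℂ, a ≠ 0 ∧ ζ' q = a • ζ q ∧
      ∀ v, ∃ b : ℂ, dlift ζ' q v = a • dlift ζ q v + b • ζ q := by
  obtain ⟨a, ha, haζ⟩ := h.exists_smul h' hq hq'
  refine ⟨a, ha, haζ, fun v => ?_⟩
  have hs := mem_chart_source ℂ q
  set φ := chartAt ℂ q with hφ
  set Z := ζ ∘ φ.symm with hZ
  set Z' := ζ' ∘ φ.symm with hZ'
  have hd : HasDerivAt Z (deriv Z (φ q)) (φ q) := h.hasDerivAt hq hs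
  have hd' : HasDerivAt Z' (deriv Z' (φ q)) (φ q) := h'.hasDerivAt hq' hs
  have hZq : Z (φ q) = ζ q := by simp [hZ, φ.left_inv hs]
  have hZq' : Z' (φ q) = ζ' q := by simp [hZ', φ.left_inv hs]
  obtain ⟨i, hi⟩ : ∃ i, ζ q i ≠ 0 := Function.ne_iff.mp (h.lifts q hq).1
  -- Cross-multiplying by a coordinate that is nonzero at q gives an identity without quotients;
  -- differentiating it and dividing by that coordinate yields b.
  have hev : (fun z => Z z i • Z' z) =ᶠ[nhds (φ q)] fun z => Z' z i • Z z := by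
    filter_upwards [(h.isOpen_chart q).mem_nhds ⟨φ.map_source hs, by
        rw [Set.mem_preimage, φ.left_inv hs]; exact hq⟩,
      (h'.isOpen_chart q).mem_nhds ⟨φ.map_source hs, by
        rw [Set.mem_preimage, φ.left_inv hs]; exact hq'⟩] with z hz hz'
    obtain ⟨c, -, hc⟩ := h.exists_smul h' hz.2 hz'.2
    simp only [hZ, hZ', Function.comp_apply, hφ, hc, Pi.smul_apply, smul_eq_mul, smul_smul]
    rw [mul_comm]
  have e1 := ((hasDerivAt_pi.mp hd i).smul hd')
  have e2 := ((hasDerivAt_pi.mp hd' i).smul hd)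
  have e := e1.unique (e2.congr_of_eventuallyEq hev)
  rw [hZq, hZq', haζ] at e
  rw [h.dlift_eq hq hs, h'.dlift_eq hq' hs]
  set c := (show ℂ from mfderiv 𝓘(ℂ) 𝓘(ℂ) φ q v)
  refine ⟨c * ((ζ q i)⁻¹ * (deriv Z' (φ q) i - deriv Z (φ q) i * a)), ?_⟩
  have e' : deriv Z' (φ q) = a • deriv Z (φ q) +
      ((ζ q i)⁻¹ * (deriv Z' (φ q) i - deriv Z (φ q) i * a)) • ζ q := by
    funext j
    have ej := congrFun e j
    simp only [Pi.add_apply, Pi.smul_apply, smul_eq_mul] at ej ⊢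
    field_simp
    linear_combination ej
  conv_lhs => rw [e']
  rw [smul_add, smul_smul, smul_smul, smul_smul, mul_comm a c]

theorem IsHolomorphicLift.lorentz_dlift (h : IsHolomorphicLift ξ U ζ)
    (hξ : IsOneIsotropicCurve ξ) (hq : q ∈ U) (v : TangentSpace 𝓘(ℂ) q) :
    lorentz (ζ q) (dlift ζ q v) = 0 := by
  have hs := mem_chart_source ℂ q
  rw [h.dlift_eq hq hs, lorentz_smul_right]
  have hd := h.hasDerivAt hq hs
  have e1 := hasDerivAt_lorentz hd hd
  have hev : (fun z => lorentz ((ζ ∘ (chartAt ℂ q).symm) z) ((ζ ∘ (chartAt ℂ q).symm) z))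
      =ᶠ[nhds (chartAt ℂ q q)] fun _ => 0 := by
    filter_upwards [(h.isOpen_chart q).mem_nhds ⟨(chartAt ℂ q).map_source hs, by
        rw [Set.mem_preimage, (chartAt ℂ q).left_inv hs]; exact hq⟩] with z hz
    exact (h.null_and_pos hξ hz.2).1
  have e := e1.unique ((hasDerivAt_const _ (0 : ℂ)).congr_of_eventuallyEq hev)
  rw [lorentz_comm, Function.comp_apply, (chartAt ℂ q).left_inv hs, ← two_mul] at e
  rw [(mul_eq_zero.mp e).resolve_left two_ne_zero, mul_zero]

/-- The curve provides isotropy for one lift only. It passes to every lift because the gauge terms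
meet ⟨ζ, ζ⟩ = 0 and ⟨ζ, dζ⟩ = 0. -/
theorem IsHolomorphicLift.lorentz_dlift_dlift (h : IsHolomorphicLift ξ U ζ)
    (hξ : IsOneIsotropicCurve ξ) (hq : q ∈ U) (v : TangentSpace 𝓘(ℂ) q) :
    lorentz (dlift ζ q v) (dlift ζ q v) = 0 := by
  obtain ⟨V, ζ', hq', h', hiso⟩ := hξ.exists_lift q
  obtain ⟨a, -, -, hd⟩ := h'.gauge h hq' hq
  obtain ⟨b, hb⟩ := hd v
  have h1 := hiso q hq' v
  have h2 := h'.lorentz_dlift hξ hq' v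
  have h3 := (h'.null_and_pos hξ hq').1
  rw [hb]
  simp only [lorentz_add_left, lorentz_add_right, lorentz_smul_left, lorentz_smul_right,
    lorentz_comm (dlift ζ' q v) (ζ' q), h1, h2, h3]
  ring

theorem IsHolomorphicLift.mem_envelopeSpace_iff (h : IsHolomorphicLift ξ U ζ) (hq : q ∈ U)
    (y : Fin (k + 6) → ℝ) : y ∈ envelopeSpace ξ q ↔
      lorentz (toC y) (ζ q) = 0 ∧ ∀ v, lorentz (toC y) (dlift ζ q v) = 0 := by
  refine ⟨fun hy => hy U ζ hq h, fun ⟨h1, h2⟩ V ζ' hq' h' => ?_⟩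
  obtain ⟨a, -, ha, hd⟩ := h.gauge h' hq hq'
  refine ⟨by rw [ha, lorentz_smul_right, h1, mul_zero], fun v => ?_⟩
  obtain ⟨b, hb⟩ := hd v
  rw [hb, lorentz_add_right, lorentz_smul_right, lorentz_smul_right, h1, h2, mul_zero, mul_zero,
    add_zero]

/-- A lift of an isotropic curve to `ℂ^{k+6}`, expressed in a chart `φ` of the Riemann surface. -/
structure IsChartLift (ξ : M → ℙ ℂ (Fin (k + 6) → ℂ)) (φ : OpenPartialHomeomorph M ℂ) (D : Set ℂ)
    (Z : ℂ → Fin (k + 6) → ℂ) : Prop where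
  isOpen : IsOpen D
  subset : D ⊆ φ.target
  differentiableOn : DifferentiableOn ℂ Z D
  lifts : ∀ z ∈ D, ∃ h : Z z ≠ 0, ξ (φ.symm z) = Projectivization.mk ℂ (Z z) h
  null : ∀ z ∈ D, lorentz (Z z) (Z z) = 0
  null_deriv : ∀ z ∈ D, lorentz (Z z) (deriv Z z) = 0
  isotropic : ∀ z ∈ D, lorentz (deriv Z z) (deriv Z z) = 0
  pos : ∀ z ∈ D, 0 < (lorentz (Z z) (star (Z z))).re
  mem_envelopeSpace_iff : ∀ z ∈ D, ∀ y, y ∈ envelopeSpace ξ (φ.symm z) ↔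
    lorentz (toC y) (Z z) = 0 ∧ lorentz (toC y) (deriv Z z) = 0
  pos_of_isSpacelikeAt : ∀ z ∈ D, IsSpacelikeAt ξ (φ.symm z) →
    0 < (lorentz (horizontalPart (Z z) (deriv Z z)) (star (horizontalPart (Z z) (deriv Z z)))).re

theorem IsOneIsotropicCurve.exists_isChartLift (hξ : IsOneIsotropicCurve ξ) (q₀ : M) :
    ∃ (D : Set ℂ) (Z : ℂ → Fin (k + 6) → ℂ), chartAt ℂ q₀ q₀ ∈ D ∧
      IsChartLift ξ (chartAt ℂ q₀) D Z := by
  obtain ⟨U, ζ, hq₀, h, -⟩ := hξ.exists_lift q₀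
  set φ := chartAt ℂ q₀ with hφ
  have hs : q₀ ∈ φ.source := mem_chart_source ℂ q₀
  -- A tangent vector with chart component 1 turns `dlift` into the ordinary derivative. The tangent
  -- space is a complex line, so this vector suffices for all the conditions.
  have key : ∀ z ∈ φ.target ∩ φ.symm ⁻¹' U, ∃ v : TangentSpace 𝓘(ℂ) (φ.symm z), v ≠ 0 ∧
      dlift ζ (φ.symm z) v = deriv (ζ ∘ φ.symm) z := by
    rintro z ⟨hz, hzU⟩
    obtain ⟨v, hv0, hv⟩ := exists_mfderiv_chart_eq_one (φ.map_target hz)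
    have e := h.dlift_eq hzU (φ.map_target hz) v
    rw [hv, one_smul, φ.right_inv hz] at e
    exact ⟨v, hv0, e⟩
  refine ⟨φ.target ∩ φ.symm ⁻¹' U, ζ ∘ φ.symm, ⟨φ.map_source hs, ?_⟩, ?_⟩
  · rw [Set.mem_preimage, φ.left_inv hs]; exact hq₀
  refine ⟨h.isOpen_chart q₀, Set.inter_subset_left, h.differentiableOn_comp_chart_symm q₀,
    fun z hz => h.lifts _ hz.2, fun z hz => (h.null_and_pos hξ hz.2).1, fun z hz => ?_,
    fun z hz => ?_, fun z hz => (h.null_and_pos hξ hz.2).2, fun z hz y => ?_,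
    fun z hz hsp => ?_⟩
  · obtain ⟨v, -, hv⟩ := key z hz
    rw [← hv]; exact h.lorentz_dlift hξ hz.2 v
  · obtain ⟨v, -, hv⟩ := key z hz
    rw [← hv]; exact h.lorentz_dlift_dlift hξ hz.2 v
  · obtain ⟨v, -, hv⟩ := key z hz
    rw [h.mem_envelopeSpace_iff hz.2]
    refine and_congr Iff.rfl ⟨fun hy => hv ▸ hy v, fun hy w => ?_⟩
    rw [h.dlift_eq hz.2 (φ.map_target hz.1), φ.right_inv hz.1, lorentz_smul_right]
    exact mul_eq_zero_of_right _ hy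
  · obtain ⟨v, hv0, hv⟩ := key z hz
    obtain ⟨V, ζ', hV, h', hpos⟩ := hsp
    obtain ⟨a, ha, hζ, hd⟩ := h'.gauge h hV hz.2
    obtain ⟨b, hb⟩ := hd v
    have hne : lorentz (ζ' (φ.symm z)) (star (ζ' (φ.symm z))) ≠ 0 := fun h0 => by
      have := (h'.null_and_pos hξ hV).2
      rw [h0] at this
      exact lt_irrefl _ this
    rw [← hv, Function.comp_apply, hζ, hb, horizontalPart_gauge ha hne, re_lorentz_smul_star]
    exact mul_pos (Complex.normSq_pos.mpr ha) (hpos v hv0)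

end Curve

/-! ### Maps into the envelope -/

theorem isManifold_real_of_complex {M : Type*} [TopologicalSpace M] [ChartedSpace ℂ M]
    [IsManifold 𝓘(ℂ) ω M] : IsManifold 𝓘(ℝ, ℂ) ∞ M := by
  refine isManifold_of_contDiffOn _ _ _ fun e e' he he' => ?_
  have h := (contMDiffOn_iff_contDiffOn (𝕜 := ℂ) (n := ω)).mp
    ((contMDiffOn_of_mem_contDiffGroupoid (HasGroupoid.compatible (G := contDiffGroupoid ω 𝓘(ℂ))
      he he')))
  simpa using (h.restrict_scalars ℝ).of_le le_top

section Calculus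

variable {E : Type*} [NormedAddCommGroup E] [NormedSpace ℝ E]

/-- The product rule along a real line through `a`, with the complex chain rule for Z ∘ w. It serves
twice: with t = 1 for the incidence relation and with t = 0 for its derivative. -/
theorem lorentz_pair_deriv_eq_zero {n : ℕ} {t : ℝ} {g : E → EuclideanSpace ℝ (Fin n)} {w : E → ℂ}
    {g' : E →L[ℝ] EuclideanSpace ℝ (Fin n)} {w' : E →L[ℝ] ℂ} {Z : ℂ → Fin (n + 1) → ℂ}
    {Z' : Fin (n + 1) → ℂ} {a : E} (hg : HasFDerivAt g g' a) (hw : HasFDerivAt w w' a)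
    (hZ : HasDerivAt Z Z' (w a))
    (h0 : ∀ᶠ e in nhds a, lorentz (toC (pair t (g e))) (Z (w e)) = 0) (u : E) :
    lorentz (toC (pair 0 (g' u))) (Z (w a)) + w' u * lorentz (toC (pair t (g a))) Z' = 0 := by
  have hline : Filter.Tendsto (fun s : ℝ => a + s • u) (nhds 0) (nhds a) := by
    have : Continuous fun s : ℝ => a + s • u := by fun_prop
    simpa using this.tendsto 0
  have hg1 : HasDerivAt (fun s : ℝ => g (a + s • u)) (g' u) 0 := hg.hasLineDerivAt u
  have hw1 : HasDerivAt (fun s : ℝ => w (a + s • u)) (w' u) 0 := hw.hasLineDerivAt u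
  have hY : HasDerivAt (fun s : ℝ => toC (pair t (g (a + s • u)))) (toC (pair 0 (g' u))) 0 := by
    rw [hasDerivAt_pi]
    intro i
    refine Fin.cases ?_ (fun j => ?_) i
    · simpa [toC, pair] using hasDerivAt_const (0 : ℝ) (t : ℂ)
    · have h2 : HasDerivAt (fun s : ℝ => g (a + s • u) j) (g' u j) 0 :=
        (EuclideanSpace.proj j : EuclideanSpace ℝ (Fin n) →L[ℝ] ℝ).hasFDerivAt.comp_hasDerivAt _ hg1
      simpa [toC, pair] using h2.ofReal_comp
  have hZ1 : HasDerivAt (fun s : ℝ => Z (w (a + s • u))) (w' u • Z') 0 :=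
    HasDerivAt.scomp (0 : ℝ) (by simpa using hZ) hw1
  have e1 := hasDerivAt_lorentz hY hZ1
  have e := e1.unique ((hasDerivAt_const (0 : ℝ) (0 : ℂ)).congr_of_eventuallyEq
    (hline.eventually h0))
  simpa [lorentz_smul_right] using e

theorem inner_deriv_eq_zero {F : Type*} [NormedAddCommGroup F] [InnerProductSpace ℝ F]
    {g h : E → F} {g' h' : E →L[ℝ] F} {a : E} {c : ℝ} (hg : HasFDerivAt g g' a)
    (hh : HasFDerivAt h h' a) (h0 : ∀ᶠ e in nhds a, inner ℝ (g e) (h e) = c) (u : E) :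
    inner ℝ (g a) (h' u) + inner ℝ (g' u) (h a) = 0 := by
  have e := (hg.inner ℝ hh).unique ((hasFDerivAt_const c a).congr_of_eventuallyEq h0)
  simpa using DFunLike.congr_fun e u

end Calculus

section Envelope

variable {k : ℕ} {M : Type*} [TopologicalSpace M] [ChartedSpace ℂ M] [IsManifold 𝓘(ℂ) ω M]
  {ξ : M → ℙ ℂ (Fin (k + 6) → ℂ)}
  {E : Type*} [NormedAddCommGroup E] [NormedSpace ℝ E]
  {H : Type*} [TopologicalSpace H] {I : ModelWithCorners ℝ E H} [I.Boundaryless]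
  {N : Type*} [TopologicalSpace N] [ChartedSpace H N] [IsManifold I ∞ N]

theorem isWintgenIdealAt_of_mem_envelope [FiniteDimensional ℝ E] (hξ : IsOneIsotropicCurve ξ)
    {π : N → M}
    {f : N → EuclideanSpace ℝ (Fin (k + 5))} {W : Set N} (hE : Module.finrank ℝ E = k + 2)
    (hW : IsOpen W) (hπ : ContMDiffOn I 𝓘(ℝ, ℂ) ∞ π W)
    (hf : ContMDiffOn I 𝓘(ℝ, EuclideanSpace ℝ (Fin (k + 5))) ∞ f W)
    (hπf : ∀ p ∈ W, (π p, f p) ∈ envelope ξ) {p : N} (hp : p ∈ W) (him : IsImmersedAt I f p) :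
    IsWintgenIdealAt I f p ∧ HasMeanCurvatureSphere I f p (ξ (π p)) := by
  have := isManifold_real_of_complex (M := M)
  obtain ⟨D, Z, hzD, hZ⟩ := hξ.exists_isChartLift (π p)
  set φ := chartAt ℂ (π p) with hφ
  have hs : π p ∈ φ.source := mem_chart_source ℂ (π p)
  set ψ := extChartAt I p with hψ
  set W' := W ∩ π ⁻¹' (φ.source ∩ φ ⁻¹' D) with hW'
  have hW'o : IsOpen W' :=
    hπ.continuousOn.isOpen_inter_preimage hW (φ.isOpen_inter_preimage hZ.isOpen)
  set O := ψ.target ∩ ψ.symm ⁻¹' W' with hO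
  have hOo : IsOpen O :=
    (continuousOn_extChartAt_symm p).isOpen_inter_preimage (isOpen_extChartAt_target p) hW'o
  set a := ψ p with ha
  have hψa : ψ.symm a = p := extChartAt_to_inv p
  have haO : a ∈ O := by
    refine ⟨mem_extChartAt_target p, ?_⟩
    rw [Set.mem_preimage, hψa]
    exact ⟨hp, hs, hzD⟩
  have hψs : ContMDiffOn 𝓘(ℝ, E) I ∞ ψ.symm O :=
    (contMDiffOn_extChartAt_symm p).mono Set.inter_subset_left
  set g := f ∘ ψ.symm with hg
  set w := φ ∘ π ∘ ψ.symm with hw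
  have hgO : ContDiffOn ℝ ∞ g O :=
    (hf.comp hψs fun e he => he.2.1).contDiffOn
  have hwO : ContDiffOn ℝ ∞ w O :=
    (contMDiffOn_chart.comp (hπ.comp hψs fun e he => he.2.1) fun e he => he.2.2.1).contDiffOn
  have hgd : ∀ e ∈ O, HasFDerivAt g (fderiv ℝ g e) e := fun e he =>
    ((hgO.contDiffAt (hOo.mem_nhds he)).differentiableAt (by simp)).hasFDerivAt
  have hwd : ∀ e ∈ O, HasFDerivAt w (fderiv ℝ w e) e := fun e he =>
    ((hwO.contDiffAt (hOo.mem_nhds he)).differentiableAt (by simp)).hasFDerivAt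
  have hwD : ∀ e ∈ O, w e ∈ D := fun e he => he.2.2.2
  have hZd : ∀ e ∈ O, HasDerivAt Z (deriv Z (w e)) (w e) := fun e he =>
    (hZ.differentiableOn.differentiableAt (hZ.isOpen.mem_nhds (hwD e he))).hasDerivAt
  have hwπ : ∀ e ∈ O, φ.symm (w e) = π (ψ.symm e) := fun e he => φ.left_inv he.2.2.1
  have henv : ∀ e ∈ O, ‖g e‖ = 1 ∧ lorentz (toC (pair 1 (g e))) (Z (w e)) = 0 ∧
      lorentz (toC (pair 1 (g e))) (deriv Z (w e)) = 0 := fun e he => by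
    obtain ⟨h1, h2⟩ := hπf _ he.2.1
    refine ⟨h1, ?_⟩
    rw [← hZ.mem_envelopeSpace_iff _ (hwD e he), hwπ e he]
    exact h2
  have hgg : ∀ e ∈ O, ∀ u, inner ℝ (g e) (fderiv ℝ g e u) = 0 := fun e he u => by
    have h := inner_deriv_eq_zero (c := 1) (hgd e he) (hgd e he) (by
      filter_upwards [hOo.mem_nhds he] with e' he'
      rw [real_inner_self_eq_norm_sq, (henv e' he').1, one_pow]) u
    rw [real_inner_comm (g e)] at h
    linarith
  -- The envelope condition removes the term in the differential of w. What remains holds on all of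
  -- O and can be differentiated again without second derivatives of w or Z.
  have hgZ : ∀ e ∈ O, ∀ u, lorentz (toC (pair 0 (fderiv ℝ g e u))) (Z (w e)) = 0 :=
    fun e he u => by
      have h := lorentz_pair_deriv_eq_zero (t := 1) (hgd e he) (hwd e he) (hZd e he) (by
        filter_upwards [hOo.mem_nhds he] with e' he'
        exact (henv e' he').2.1) u
      rwa [(henv e he).2.2, mul_zero, add_zero] at h
  have hg2 : ∀ v, HasFDerivAt (fun e => fderiv ℝ g e v)
      ((ContinuousLinearMap.apply ℝ _ v).comp (fderiv ℝ (fderiv ℝ g) a)) a := fun v => by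
    have h : DifferentiableAt ℝ (fderiv ℝ g) a :=
      ((hgO.contDiffAt (hOo.mem_nhds haO)).fderiv_right (m := 1) (by
        norm_cast)).differentiableAt one_ne_zero
    exact (ContinuousLinearMap.apply ℝ _ v).hasFDerivAt.comp a h.hasFDerivAt
  have hdiff : ∀ u, differential I f p u = fderiv ℝ g a u := fun u => by
    have hmd : MDifferentiableAt I 𝓘(ℝ, EuclideanSpace ℝ (Fin (k + 5))) f p :=
      ((hf p hp).contMDiffAt (hW.mem_nhds hp)).mdifferentiableAt (by simp)
    rw [differential, hmd.mfderiv, I.range_eq_univ, fderivWithin_univ]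
    rfl
  have hhess : ∀ u v, hessian I f p u v = fderiv ℝ (fderiv ℝ g) a u v := fun _ _ => rfl
  have hfp : f p = g a := by rw [hg, Function.comp_apply, hψa]
  -- Scaling by ρ⁻¹ makes ξ₁, ξ₂ unit vectors. It is frozen at the point, so it creates no
  -- derivative terms, and the conditions on η are homogeneous, so η stays unscaled.
  set ρ := Real.sqrt ((lorentz (Z (w a)) (star (Z (w a)))).re / 2) with hρ
  have hpos := hZ.pos _ (hwD a haO)
  have hρpos : 0 < ρ := Real.sqrt_pos.mpr (by linarith)
  have hρsq : ρ ^ 2 = (lorentz (Z (w a)) (star (Z (w a)))).re / 2 := Real.sq_sqrt (by linarith)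
  obtain ⟨hZ0, hξZ⟩ := hZ.lifts _ (hwD a haO)
  have hρ0 : (ρ : ℂ)⁻¹ ≠ 0 := inv_ne_zero (by exact_mod_cast hρpos.ne')
  have hne : (ρ : ℂ)⁻¹ • Z (w a) ≠ 0 := smul_ne_zero hρ0 hZ0
  have hmk : ξ (π p) = Projectivization.mk ℂ ((ρ : ℂ)⁻¹ • Z (w a)) hne := by
    rw [hwπ a haO, hψa] at hξZ
    rw [hξZ, Projectivization.mk_eq_mk_iff']
    exact ⟨ρ, by rw [smul_smul, mul_inv_cancel₀ (by exact_mod_cast hρpos.ne'), one_smul]⟩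
  rw [hmk]
  refine isWintgenIdealAt_of_normalized (η := deriv Z (w a))
    (c := fun u => (ρ : ℂ)⁻¹ * fderiv ℝ w a u) hE him ?_ ?_ ?_ ?_ ?_ ?_ ?_ ?_ ?_ ?_ ?_ ?_ hne
  · rw [hfp]; exact (henv a haO).1
  · intro u
    rw [hfp, hdiff]; exact hgg a haO u
  · intro u v
    rw [hhess, hdiff, hdiff, hfp]
    have h := inner_deriv_eq_zero (c := 0) (hgd a haO) (hg2 v) (by
      filter_upwards [hOo.mem_nhds haO] with e he
      exact hgg e he v) u
    rw [real_inner_comm]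
    exact eq_neg_of_add_eq_zero_left h
  · intro u v
    rw [hhess, hhess]
    exact ((hgO.contDiffAt (hOo.mem_nhds haO)).isSymmSndFDerivAt (by
      rw [minSmoothness_of_isRCLikeNormedField]; norm_cast)) u v
  · rw [hfp, lorentz_smul_right, (henv a haO).2.1, mul_zero]
  · rw [hfp]; exact (henv a haO).2.2
  · intro u
    rw [hdiff, lorentz_smul_right]
    exact mul_eq_zero_of_right _ (hgZ a haO u)
  · intro u v
    have h := lorentz_pair_deriv_eq_zero (t := 0) (hg2 v) (hwd a haO) (hZd a haO) (by
      filter_upwards [hOo.mem_nhds haO] with e he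
      exact hgZ e he v) u
    rw [hhess, hdiff, lorentz_smul_right, mul_assoc, ← mul_add]
    exact mul_eq_zero_of_right _ h
  · rw [lorentz_smul_left, lorentz_smul_right, hZ.null _ (hwD a haO), mul_zero, mul_zero]
  · rw [lorentz_smul_left, hZ.null_deriv _ (hwD a haO), mul_zero]
  · exact hZ.isotropic _ (hwD a haO)
  · rw [re_lorentz_smul_star, ← Complex.ofReal_inv, Complex.normSq_ofReal]
    have : (lorentz (Z (w a)) (star (Z (w a)))).re = 2 * ρ ^ 2 := by rw [hρsq]; ring
    rw [this]
    field_simp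

end Envelope

/-! ### The parametrization of the envelope by a frame -/

theorem lorentz_pair_self {n : ℕ} (t : ℝ) (x : EuclideanSpace ℝ (Fin n)) :
    lorentz (pair t x) (pair t x) = -(t * t) + ‖x‖ ^ 2 := by
  rw [EuclideanSpace.real_norm_sq_eq]
  simp [lorentz, pair, sq]

theorem eq_zero_of_lorentz_self_eq_zero {n : ℕ} {Y : Fin (n + 1) → ℝ} (hY : lorentz Y Y = 0)
    (h0 : Y 0 = 0) : Y = 0 := by
  rw [lorentz, h0, mul_zero, neg_zero, zero_add,
    Finset.sum_eq_zero_iff_of_nonneg fun i _ => mul_self_nonneg _] at hY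
  funext i
  refine Fin.cases h0 (fun j => ?_) i
  exact mul_self_eq_zero.mp (hY j (Finset.mem_univ j))

theorem envelopeLift_eq {k : ℕ} {M : Type*} (e₀ : M → Fin (k + 6) → ℝ)
    (e : Fin (k + 1) → M → Fin (k + 6) → ℝ) (p : M × FiberSphere k) : envelopeLift e₀ e p =
    (1 : ℝ) • e₀ p.1 + ∑ j, (p.2 : EuclideanSpace ℝ (Fin (k + 1))) j • e j p.1 := by
  rw [one_smul]; rfl

section Frame

variable {k : ℕ} {M : Type*} [TopologicalSpace M] [ChartedSpace ℂ M]
  {ξ : M → ℙ ℂ (Fin (k + 6) → ℂ)} {U : Set M} {e₀ : M → Fin (k + 6) → ℝ}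
  {e : Fin (k + 1) → M → Fin (k + 6) → ℝ}

theorem IsEnvelopeFrame.lorentz_zero (h : IsEnvelopeFrame ξ U e₀ e) {q : M} (hq : q ∈ U) (a : ℝ)
    (b : Fin (k + 1) → ℝ) : lorentz (a • e₀ q + ∑ j, b j • e j q) (e₀ q) = -a := by
  rw [lorentz_add_left, lorentz_smul_left, h.timelike q hq, lorentz_sum_left,
    Finset.sum_eq_zero fun j _ => by
      rw [lorentz_smul_left, lorentz_comm, h.orthogonal q hq, mul_zero]]
  ring

theorem IsEnvelopeFrame.lorentz_apply (h : IsEnvelopeFrame ξ U e₀ e) {q : M} (hq : q ∈ U) (a : ℝ)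
    (b : Fin (k + 1) → ℝ) (i : Fin (k + 1)) :
    lorentz (a • e₀ q + ∑ j, b j • e j q) (e i q) = b i := by
  simp [lorentz_add_left, lorentz_smul_left, h.orthogonal q hq, lorentz_sum_left,
    h.orthonormal q hq]

theorem IsEnvelopeFrame.lorentz_self (h : IsEnvelopeFrame ξ U e₀ e) {q : M} (hq : q ∈ U) (a : ℝ)
    (b : Fin (k + 1) → ℝ) :
    lorentz (a • e₀ q + ∑ j, b j • e j q) (a • e₀ q + ∑ j, b j • e j q) =
      -a ^ 2 + ∑ j, b j ^ 2 := by
  rw [lorentz_add_right, lorentz_smul_right, lorentz_sum_right, h.lorentz_zero hq]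
  simp only [lorentz_smul_right, h.lorentz_apply hq]
  simp only [sq]
  ring

theorem fiberSphere_sum_sq (Θ : FiberSphere k) :
    ∑ j, (Θ : EuclideanSpace ℝ (Fin (k + 1))) j ^ 2 = 1 := by
  rw [← EuclideanSpace.real_norm_sq_eq, norm_eq_of_mem_sphere, one_pow]

/-- A null vector without time component is zero, yet Ŷ pairs to -1 with e₀. -/
theorem IsEnvelopeFrame.envelopeLift_zero_ne (h : IsEnvelopeFrame ξ U e₀ e)
    {p : M × FiberSphere k} (hp : p.1 ∈ U) : envelopeLift e₀ e p 0 ≠ 0 := by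
  intro h0
  have hnull : lorentz (envelopeLift e₀ e p) (envelopeLift e₀ e p) = 0 := by
    rw [envelopeLift_eq, h.lorentz_self hp, fiberSphere_sum_sq]; norm_num
  have h1 : lorentz (envelopeLift e₀ e p) (e₀ p.1) = -1 := by
    rw [envelopeLift_eq, h.lorentz_zero hp]
  rw [eq_zero_of_lorentz_self_eq_zero hnull h0, lorentz_zero_left] at h1
  norm_num at h1

theorem IsEnvelopeFrame.pair_envelopeMap (h : IsEnvelopeFrame ξ U e₀ e)
    {p : M × FiberSphere k} (hp : p.1 ∈ U) :
    pair 1 (envelopeMap e₀ e p) = (envelopeLift e₀ e p 0)⁻¹ • envelopeLift e₀ e p := by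
  have h0 := h.envelopeLift_zero_ne hp
  funext i
  refine Fin.cases ?_ (fun j => ?_) i
  · simp [pair, h0]
  · simp [pair, envelopeMap, div_eq_inv_mul]

theorem IsEnvelopeFrame.mem_envelope (h : IsEnvelopeFrame ξ U e₀ e)
    {p : M × FiberSphere k} (hp : p.1 ∈ U) : (p.1, envelopeMap e₀ e p) ∈ envelope ξ := by
  have h1 : lorentz (pair 1 (envelopeMap e₀ e p)) (pair 1 (envelopeMap e₀ e p)) = 0 := by
    rw [h.pair_envelopeMap hp, lorentz_smul_left, lorentz_smul_right, envelopeLift_eq,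
      h.lorentz_self hp, fiberSphere_sum_sq]
    ring
  refine ⟨?_, ?_⟩
  · rw [lorentz_pair_self] at h1
    exact (pow_eq_one_iff_of_nonneg (norm_nonneg _) two_ne_zero).mp (by linarith)
  · rw [h.pair_envelopeMap hp, ← h.span_eq _ hp]
    refine Submodule.smul_mem _ _ (Submodule.add_mem _ (Submodule.subset_span (by simp)) ?_)
    exact Submodule.sum_mem _ fun j _ =>
      Submodule.smul_mem _ _ (Submodule.subset_span (Set.mem_insert_of_mem _ ⟨j, rfl⟩))

theorem IsEnvelopeFrame.bijOn (h : IsEnvelopeFrame ξ U e₀ e) :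
    Set.BijOn (fun p : M × FiberSphere k => (p.1, envelopeMap e₀ e p))
      (U ×ˢ Set.univ) {z ∈ envelope ξ | z.1 ∈ U} := by
  refine ⟨fun p hp => ⟨h.mem_envelope hp.1, hp.1⟩, ?_, ?_⟩
  · rintro ⟨q, Θ⟩ ⟨hq, -⟩ ⟨q', Θ'⟩ - heq
    obtain ⟨rfl, hx⟩ : q = q' ∧ envelopeMap e₀ e (q, Θ) = envelopeMap e₀ e (q', Θ') := by
      simpa using heq
    have hY := congrArg (pair 1) hx
    rw [h.pair_envelopeMap hq, h.pair_envelopeMap (p := (q, Θ')) hq] at hY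
    -- Both lifts pair to -1 with e₀, which forces their scale factors to agree.
    have h0 := congrArg (fun Y => lorentz Y (e₀ q)) hY
    simp only [lorentz_smul_left] at h0
    rw [envelopeLift_eq e₀ e (q, Θ), envelopeLift_eq e₀ e (q, Θ'), h.lorentz_zero hq, h.lorentz_zero hq,
      ← envelopeLift_eq e₀ e (q, Θ), ← envelopeLift_eq e₀ e (q, Θ')] at h0
    have h0' := mul_right_cancel₀ (by norm_num) h0
    rw [h0'] at hY
    have hYY := smul_right_injective _ (inv_ne_zero (h.envelopeLift_zero_ne (p := (q, Θ')) hq)) hY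
    have hΘ : Θ = Θ' := by
      ext j
      have hj := congrArg (fun Y => lorentz Y (e j q)) hYY
      rwa [envelopeLift_eq, envelopeLift_eq, h.lorentz_apply hq, h.lorentz_apply hq] at hj
    rw [hΘ]
  · rintro ⟨q, x⟩ ⟨⟨hx, hxV⟩, hq⟩
    simp only at hx hxV hq
    rw [← h.span_eq q hq, Submodule.mem_span_insert] at hxV
    obtain ⟨a, y, hy, hxy⟩ := hxV
    obtain ⟨b, rfl⟩ := (Submodule.mem_span_range_iff_exists_fun ℝ).mp hy
    have hnull : -a ^ 2 + ∑ j, b j ^ 2 = 0 := by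
      rw [← h.lorentz_self hq, ← hxy, lorentz_pair_self, hx]; norm_num
    -- With a = 0 nullity would kill every b j, contradicting the time component 1 of (1, x).
    have ha : a ≠ 0 := by
      rintro rfl
      have hb : ∑ j, b j ^ 2 = 0 := by linarith
      rw [Finset.sum_eq_zero_iff_of_nonneg fun i _ => sq_nonneg _] at hb
      have hb' : ∀ j, b j = 0 := fun j => by simpa using hb j (Finset.mem_univ j)
      have h1 := congrFun hxy 0
      simp [pair, hb'] at h1
    -- The sign of a is irrelevant: `envelopeMap` divides by the time component, whatever its sign.
    let Θ : EuclideanSpace ℝ (Fin (k + 1)) := WithLp.toLp 2 fun j => a⁻¹ * b j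
    have hΘ : ‖Θ‖ = 1 := by
      have : ‖Θ‖ ^ 2 = 1 := by
        rw [EuclideanSpace.real_norm_sq_eq]
        simp only [Θ, mul_pow, ← Finset.mul_sum]
        rw [show ∑ j, b j ^ 2 = a ^ 2 by linarith]
        field_simp
      exact (pow_eq_one_iff_of_nonneg (norm_nonneg _) two_ne_zero).mp this
    let p : M × FiberSphere k := (q, ⟨Θ, by simpa using hΘ⟩)
    have hY : envelopeLift e₀ e p = a⁻¹ • pair 1 x := by
      rw [hxy, smul_add, smul_smul, inv_mul_cancel₀ ha, one_smul, Finset.smul_sum]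
      simp only [smul_smul]
      rfl
    refine ⟨p, ⟨hq, Set.mem_univ _⟩, Prod.ext rfl ?_⟩
    ext i
    simp only [envelopeMap, hY, pair, Pi.smul_apply, Fin.cons_succ, Fin.cons_zero, smul_eq_mul]
    field_simp

theorem IsEnvelopeFrame.contMDiffOn (h : IsEnvelopeFrame ξ U e₀ e) :
    ContMDiffOn (𝓘(ℝ, ℂ).prod (𝓡 k)) 𝓘(ℝ, EuclideanSpace ℝ (Fin (k + 5))) ∞
      (envelopeMap e₀ e) (U ×ˢ Set.univ) := by
  have hfst : ContMDiffOn (𝓘(ℝ, ℂ).prod (𝓡 k)) 𝓘(ℝ, ℂ) ∞ (Prod.fst : M × FiberSphere k → M)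
      (U ×ˢ Set.univ) := contMDiffOn_fst
  have hmaps : Set.MapsTo (Prod.fst : M × FiberSphere k → M) (U ×ˢ Set.univ) U := fun p hp => hp.1
  have hΘ : ContMDiff (𝓘(ℝ, ℂ).prod (𝓡 k)) 𝓘(ℝ, EuclideanSpace ℝ (Fin (k + 1))) ∞
      (fun p : M × FiberSphere k => (p.2 : EuclideanSpace ℝ (Fin (k + 1)))) :=
    haveI := Fact.mk (finrank_euclideanSpace_fin (𝕜 := ℝ) (n := k + 1))
    (contMDiff_coe_sphere (E := EuclideanSpace ℝ (Fin (k + 1))) (n := k)).comp contMDiff_snd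
  have hΘj : ∀ j, ContMDiff (𝓘(ℝ, ℂ).prod (𝓡 k)) 𝓘(ℝ, ℝ) ∞
      (fun p : M × FiberSphere k => (p.2 : EuclideanSpace ℝ (Fin (k + 1))) j) := fun j =>
    (EuclideanSpace.proj j : EuclideanSpace ℝ (Fin (k + 1)) →L[ℝ] ℝ).contDiff.contMDiff.comp hΘ
  have hlift : ContMDiffOn (𝓘(ℝ, ℂ).prod (𝓡 k)) 𝓘(ℝ, Fin (k + 6) → ℝ) ∞
      (envelopeLift e₀ e) (U ×ˢ Set.univ) :=
    (h.smooth_zero.comp hfst hmaps).add (contMDiffOn_finsetSum fun j _ =>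
      (hΘj j).contMDiffOn.smul ((h.smooth j).comp hfst hmaps))
  have hquot : ContDiffOn ℝ ∞ (fun Y : Fin (k + 6) → ℝ =>
      (WithLp.toLp 2 fun i : Fin (k + 5) => Y i.succ / Y 0 : EuclideanSpace ℝ (Fin (k + 5))))
      {Y | Y 0 ≠ 0} := by
    rw [contDiffOn_euclidean]
    intro i
    exact ContDiffOn.div (contDiff_apply ℝ ℝ _).contDiffOn (contDiff_apply ℝ ℝ _).contDiffOn
      fun Y hY => hY
  exact hquot.contMDiffOn.comp hlift fun p hp => h.envelopeLift_zero_ne hp.1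

theorem IsEnvelopeFrame.isWintgenIdealAt [IsManifold 𝓘(ℂ) ω M] (hξ : IsOneIsotropicCurve ξ)
    (hU : IsOpen U)
    (h : IsEnvelopeFrame ξ U e₀ e) {p : M × FiberSphere k} (hp : p.1 ∈ U)
    (him : IsImmersedAt (𝓘(ℝ, ℂ).prod (𝓡 k)) (envelopeMap e₀ e) p) :
    IsWintgenIdealAt (𝓘(ℝ, ℂ).prod (𝓡 k)) (envelopeMap e₀ e) p ∧
      HasMeanCurvatureSphere (𝓘(ℝ, ℂ).prod (𝓡 k)) (envelopeMap e₀ e) p (ξ p.1) := by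
  have := isManifold_real_of_complex (M := M)
  refine isWintgenIdealAt_of_mem_envelope (π := Prod.fst) (W := U ×ˢ Set.univ) hξ ?_
    (hU.prod isOpen_univ) contMDiffOn_fst h.contMDiffOn (fun p hp => h.mem_envelope hp.1)
    ⟨hp, Set.mem_univ _⟩ him
  rw [Module.finrank_prod, Complex.finrank_real_complex, finrank_euclideanSpace_fin, add_comm]

end Frame

/-! ### Pseudo-orthonormal families -/

/-- A pseudo-orthonormal family: `e` is a time-like unit vector and the `w i` are space-like. -/
structure IsLorentzFrame {n s : ℕ} (e : Fin (n + 1) → ℝ) (w : Fin s → Fin (n + 1) → ℝ) : Prop where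
  timelike : lorentz e e = -1
  orthogonal : ∀ i, lorentz e (w i) = 0
  orthonormal : ∀ i j, lorentz (w i) (w j) = if i = j then 1 else 0

/-- Let S, T be the squared lengths of the space parts of e, c, so S < e₀². If T ≤ c₀²,
Cauchy–Schwarz gives e₀²c₀² ≤ ST < e₀²T ≤ e₀²c₀². -/
theorem lorentz_self_pos_of_orthogonal {n : ℕ} {e c : Fin (n + 1) → ℝ} (he : lorentz e e < 0)
    (hc : lorentz e c = 0) (hc0 : c ≠ 0) : 0 < lorentz c c := by
  have hcs := Finset.sum_mul_sq_le_sq_mul_sq Finset.univ (fun i : Fin n => e i.succ)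
    (fun i : Fin n => c i.succ)
  simp only [lorentz, ← sq] at *
  set S := ∑ i : Fin n, e i.succ ^ 2
  set T := ∑ i : Fin n, c i.succ ^ 2 with hT
  have hT0 : 0 ≤ T := Finset.sum_nonneg fun i _ => sq_nonneg _
  have hS0 : 0 ≤ S := Finset.sum_nonneg fun i _ => sq_nonneg _
  have h1 : ∑ i : Fin n, e i.succ * c i.succ = e 0 * c 0 := by linarith
  rw [h1, mul_pow] at hcs
  have hTpos : 0 < T := by
    refine lt_of_le_of_ne hT0 fun h => hc0 ?_
    have h2 : ∀ i : Fin n, c i.succ = 0 := fun i => by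
      have := (Finset.sum_eq_zero_iff_of_nonneg fun i _ => sq_nonneg _).mp (hT.symm.trans h.symm) i
        (Finset.mem_univ i)
      simpa using this
    have h3 : c 0 ^ 2 = 0 := by
      rw [← h, mul_zero] at hcs
      have h5 : 0 < e 0 ^ 2 := by linarith
      have h6 := mul_nonneg (sq_nonneg (e 0)) (sq_nonneg (c 0))
      exact (mul_eq_zero.mp (le_antisymm hcs h6)).resolve_left h5.ne'
    funext i
    exact Fin.cases (by simpa using h3) h2 i
  by_contra hle
  have h7 : T ≤ c 0 ^ 2 := by linarith
  have h8 : S * T < e 0 ^ 2 * T := mul_lt_mul_of_pos_right (by linarith) hTpos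
  have h9 : e 0 ^ 2 * T ≤ e 0 ^ 2 * c 0 ^ 2 := mul_le_mul_of_nonneg_left h7 (sq_nonneg _)
  linarith

/-- The components of a vector along a family. -/
def lorentzComponents {n s : ℕ} (e : Fin (n + 1) → ℝ) (w : Fin s → Fin (n + 1) → ℝ) :
    (Fin (n + 1) → ℝ) →ₗ[ℝ] ℝ × (Fin s → ℝ) :=
  (lorentzForm ℝ n e).prod (LinearMap.pi fun i => lorentzForm ℝ n (w i))

theorem lorentzComponents_eq_zero_iff {n s : ℕ} {e : Fin (n + 1) → ℝ} {w : Fin s → Fin (n + 1) → ℝ}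
    {y : Fin (n + 1) → ℝ} :
    lorentzComponents e w y = 0 ↔ lorentz e y = 0 ∧ ∀ i, lorentz (w i) y = 0 := by
  rw [Prod.ext_iff, funext_iff]
  rfl

/-- The part of a vector that is orthogonal to a pseudo-orthonormal family. -/
def lorentzReject {n s : ℕ} (e : Fin (n + 1) → ℝ) (w : Fin s → Fin (n + 1) → ℝ)
    (y : Fin (n + 1) → ℝ) : Fin (n + 1) → ℝ :=
  y + lorentz y e • e - ∑ i, lorentz y (w i) • w i

namespace IsLorentzFrame

variable {n s : ℕ} {e : Fin (n + 1) → ℝ} {w : Fin s → Fin (n + 1) → ℝ}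

theorem lorentz_reject (h : IsLorentzFrame e w) (y : Fin (n + 1) → ℝ) :
    lorentz e (lorentzReject e w y) = 0 := by
  simp [lorentzReject, lorentz_sub_right, lorentz_add_right, lorentz_smul_right, lorentz_sum_right,
    h.timelike, h.orthogonal, lorentz_comm e y]

theorem lorentz_reject_apply (h : IsLorentzFrame e w) (y : Fin (n + 1) → ℝ) (i : Fin s) :
    lorentz (w i) (lorentzReject e w y) = 0 := by
  simp [lorentzReject, lorentz_sub_right, lorentz_add_right, lorentz_smul_right, lorentz_sum_right,
    h.orthonormal, h.orthogonal, lorentz_comm (w i) e, lorentz_comm (w i) y]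

theorem exists_ne_zero (e : Fin (n + 1) → ℝ) (w : Fin s → Fin (n + 1) → ℝ) (hs : s < n) :
    ∃ c : Fin (n + 1) → ℝ, c ≠ 0 ∧ lorentz e c = 0 ∧ ∀ i, lorentz (w i) c = 0 := by
  have hker : LinearMap.ker (lorentzComponents e w) ≠ ⊥ :=
    LinearMap.ker_ne_bot_of_finrank_lt (by simp; omega)
  obtain ⟨c, hc, hc0⟩ := Submodule.exists_mem_ne_zero_of_ne_bot hker
  rw [LinearMap.mem_ker, lorentzComponents_eq_zero_iff] at hc
  exact ⟨c, hc0, hc⟩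

/-- The component map hits every value by an explicit combination of the family; between spaces of
equal dimension it is then injective. -/
theorem eq_zero_of_orthogonal (h : IsLorentzFrame e w) (hs : s = n) {y : Fin (n + 1) → ℝ}
    (hy : lorentz e y = 0) (hyw : ∀ i, lorentz (w i) y = 0) : y = 0 := by
  have hsurj : Function.Surjective (lorentzComponents e w) := by
    rintro ⟨a, b⟩
    refine ⟨-a • e + ∑ i, b i • w i, ?_⟩
    refine Prod.ext ?_ (funext fun i => ?_)
    · change lorentz e (-a • e + ∑ i, b i • w i) = a
      simp [-neg_smul, lorentz_add_right, lorentz_smul_right, lorentz_sum_right, h.timelike,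
        h.orthogonal]
    · change lorentz (w i) (-a • e + ∑ i, b i • w i) = b i
      simp [-neg_smul, lorentz_add_right, lorentz_smul_right, lorentz_sum_right, h.orthonormal,
        lorentz_comm (w i) e, h.orthogonal]
  have hinj : Function.Injective (lorentzComponents e w) :=
    (LinearMap.injective_iff_surjective_of_finrank_eq_finrank (by simp; omega)).mpr hsurj
  refine hinj ?_
  rw [map_zero]
  exact lorentzComponents_eq_zero_iff.mpr ⟨hy, hyw⟩

theorem eq_sum (h : IsLorentzFrame e w) (hs : s = n) (y : Fin (n + 1) → ℝ) :
    y = -lorentz y e • e + ∑ i, lorentz y (w i) • w i := by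
  have := h.eq_zero_of_orthogonal hs (h.lorentz_reject y) (h.lorentz_reject_apply y)
  rw [lorentzReject, sub_eq_zero] at this
  rw [← this, neg_smul]
  abel

theorem snoc (h : IsLorentzFrame e w) {b : Fin (n + 1) → ℝ} (hb : lorentz b b = 1)
    (heb : lorentz e b = 0) (hwb : ∀ i, lorentz (w i) b = 0) :
    IsLorentzFrame e (Fin.snoc w b : Fin (s + 1) → Fin (n + 1) → ℝ) := by
  refine ⟨h.timelike, fun i => ?_, fun i j => ?_⟩
  · refine Fin.lastCases ?_ (fun i => ?_) i
    · rwa [Fin.snoc_last]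
    · rw [Fin.snoc_castSucc]; exact h.orthogonal i
  · refine Fin.lastCases ?_ (fun i => ?_) i <;> refine Fin.lastCases ?_ (fun j => ?_) j
    · simp [hb]
    · simp [lorentz_comm b, hwb, (Fin.castSucc_lt_last j).ne']
    · simp [hwb, (Fin.castSucc_lt_last i).ne]
    · simp [h.orthonormal]

end IsLorentzFrame

/-! ### Smooth pseudo-orthonormal frames -/

section Smooth

variable {G : Type*} [NormedAddCommGroup G] [NormedSpace ℝ G]

theorem contDiffOn_lorentz {A : Type*} [NormedCommRing A] [NormedAlgebra ℝ A] {n : ℕ} {D : Set G}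
    {Y Z : G → Fin (n + 1) → A} (hY : ContDiffOn ℝ ∞ Y D) (hZ : ContDiffOn ℝ ∞ Z D) :
    ContDiffOn ℝ ∞ (fun z => lorentz (Y z) (Z z)) D := by
  have hY' := contDiffOn_pi.mp hY
  have hZ' := contDiffOn_pi.mp hZ
  exact ((hY' 0).mul (hZ' 0)).neg.add
    (ContDiffOn.sum fun i _ => (hY' i.succ).mul (hZ' i.succ))

theorem contDiffOn_inv_sqrt_smul {n : ℕ} {D : Set G} {r : G → ℝ} {X : G → Fin n → ℝ}
    (hr : ContDiffOn ℝ ∞ r D) (hX : ContDiffOn ℝ ∞ X D) (hpos : ∀ z ∈ D, 0 < r z) :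
    ContDiffOn ℝ ∞ (fun z => (Real.sqrt (r z))⁻¹ • X z) D :=
  ((hr.sqrt fun z hz => (hpos z hz).ne').inv fun z hz => (Real.sqrt_pos.mpr (hpos z hz)).ne').smul
    hX

theorem contDiffOn_lorentzReject {n s : ℕ} {D : Set G} {e y : G → Fin (n + 1) → ℝ}
    {w : Fin s → G → Fin (n + 1) → ℝ} (he : ContDiffOn ℝ ∞ e D) (hy : ContDiffOn ℝ ∞ y D)
    (hw : ∀ i, ContDiffOn ℝ ∞ (w i) D) :
    ContDiffOn ℝ ∞ (fun z => lorentzReject (e z) (fun i => w i z) (y z)) D :=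
  (hy.add ((contDiffOn_lorentz hy he).smul he)).sub
    (ContDiffOn.sum fun i _ => (contDiffOn_lorentz hy (hw i)).smul (hw i))

/-- One Gram–Schmidt step. A constant vector orthogonal to the family at z₀ is space-like there; its
part orthogonal to the moving family stays space-like nearby and is normalized. -/
theorem exists_isLorentzFrame_snoc {n s : ℕ} (hs : s < n) {D : Set G} (hD : IsOpen D)
    {e : G → Fin (n + 1) → ℝ} {w : Fin s → G → Fin (n + 1) → ℝ} (he : ContDiffOn ℝ ∞ e D)
    (hw : ∀ i, ContDiffOn ℝ ∞ (w i) D) (h : ∀ z ∈ D, IsLorentzFrame (e z) (fun i => w i z))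
    {z₀ : G} (hz₀ : z₀ ∈ D) :
    ∃ (D' : Set G) (w' : Fin (s + 1) → G → Fin (n + 1) → ℝ), IsOpen D' ∧ z₀ ∈ D' ∧ D' ⊆ D ∧
      (∀ i, ContDiffOn ℝ ∞ (w' i) D') ∧ (∀ z ∈ D', IsLorentzFrame (e z) (fun i => w' i z)) ∧
      ∀ i, w' (Fin.castSucc i) = w i := by
  obtain ⟨c, hc0, hec, hwc⟩ := IsLorentzFrame.exists_ne_zero (e z₀) (fun i => w i z₀) hs
  set X : G → Fin (n + 1) → ℝ := fun z => lorentzReject (e z) (fun i => w i z) c with hX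
  have hXs : ContDiffOn ℝ ∞ X D := contDiffOn_lorentzReject he contDiffOn_const hw
  have hr := contDiffOn_lorentz hXs hXs
  have hXz₀ : X z₀ = c := by
    simp [hX, lorentzReject, lorentz_comm c, hec, hwc]
  have hb := contDiffOn_inv_sqrt_smul (D := D ∩ (fun z => lorentz (X z) (X z)) ⁻¹' Set.Ioi 0)
    (hr.mono Set.inter_subset_left) (hXs.mono Set.inter_subset_left) fun z hz => hz.2
  set b : G → Fin (n + 1) → ℝ := fun z => (Real.sqrt (lorentz (X z) (X z)))⁻¹ • X z
  have hsnoc : ∀ z, (fun i => (Fin.snoc w b : Fin (s + 1) → G → Fin (n + 1) → ℝ) i z) =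
      (Fin.snoc (fun i => w i z) (b z) : Fin (s + 1) → Fin (n + 1) → ℝ) := fun z => by
    funext i
    refine Fin.lastCases ?_ (fun i => ?_) i
    · rw [Fin.snoc_last, Fin.snoc_last]
    · rw [Fin.snoc_castSucc, Fin.snoc_castSucc]
  refine ⟨D ∩ (fun z => lorentz (X z) (X z)) ⁻¹' Set.Ioi 0,
    (Fin.snoc w b : Fin (s + 1) → G → Fin (n + 1) → ℝ),
    hr.continuousOn.isOpen_inter_preimage hD isOpen_Ioi, ⟨hz₀, ?_⟩, Set.inter_subset_left,
    fun i => ?_, fun z hz => hsnoc z ▸ (h z hz.1).snoc ?_ ?_ fun i => ?_,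
    fun i => Fin.snoc_castSucc (α := fun _ => G → Fin (n + 1) → ℝ) b w i⟩
  · rw [Set.mem_preimage, hXz₀]
    exact lorentz_self_pos_of_orthogonal (by rw [(h z₀ hz₀).timelike]; norm_num) hec hc0
  · refine Fin.lastCases ?_ (fun i => ?_) i
    · rwa [Fin.snoc_last]
    · rw [Fin.snoc_castSucc]; exact (hw i).mono Set.inter_subset_left
  · have hpos : 0 < lorentz (X z) (X z) := hz.2
    rw [lorentz_smul_left, lorentz_smul_right]
    have := Real.sq_sqrt hpos.le
    have h0 := (Real.sqrt_pos.mpr hpos).ne'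
    field_simp
    exact this.symm
  · rw [lorentz_smul_right]
    exact mul_eq_zero_of_right _ ((h z hz.1).lorentz_reject c)
  · rw [lorentz_smul_right]
    exact mul_eq_zero_of_right _ ((h z hz.1).lorentz_reject_apply c i)

/-- The original vectors keep their places, so that the added ones, with e, can later be recognized
as a frame of their orthogonal complement. -/
theorem exists_isLorentzFrame_extension {n s : ℕ} {D : Set G} (hD : IsOpen D)
    {e : G → Fin (n + 1) → ℝ} {v : Fin s → G → Fin (n + 1) → ℝ} (he : ContDiffOn ℝ ∞ e D)
    (hv : ∀ i, ContDiffOn ℝ ∞ (v i) D) (h : ∀ z ∈ D, IsLorentzFrame (e z) (fun i => v i z))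
    {z₀ : G} (hz₀ : z₀ ∈ D) (t : ℕ) (ht : s + t ≤ n) :
    ∃ (D' : Set G) (w : Fin (s + t) → G → Fin (n + 1) → ℝ), IsOpen D' ∧ z₀ ∈ D' ∧ D' ⊆ D ∧
      (∀ i, ContDiffOn ℝ ∞ (w i) D') ∧ (∀ z ∈ D', IsLorentzFrame (e z) (fun i => w i z)) ∧
      ∀ i, w (Fin.castAdd t i) = v i := by
  induction t with
  | zero => exact ⟨D, v, hD, hz₀, subset_rfl, hv, h, fun i => rfl⟩
  | succ t ih =>
    obtain ⟨D₁, w, hD₁, hz₁, hD₁D, hw, hfr, hwv⟩ := ih (by omega)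
    obtain ⟨D₂, w', hD₂, hz₂, hD₂D, hw', hfr', hww'⟩ := exists_isLorentzFrame_snoc (by omega) hD₁
      (he.mono hD₁D) hw hfr hz₁
    exact ⟨D₂, w', hD₂, hz₂, hD₂D.trans hD₁D, hw', hfr',
      fun i => (hww' (Fin.castAdd t i)).trans (hwv i)⟩

/-- Subtracting from τ = (1, 0, …, 0) its components along the family leaves a vector of square -1 -
∑⟨τ, v i⟩² ≤ -1, so D need not shrink. -/
theorem exists_timelike {n s : ℕ} {D : Set G} {v : Fin s → G → Fin (n + 1) → ℝ}
    (hv : ∀ i, ContDiffOn ℝ ∞ (v i) D)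
    (h : ∀ z ∈ D, ∀ i j, lorentz (v i z) (v j z) = if i = j then 1 else 0) :
    ∃ e : G → Fin (n + 1) → ℝ, ContDiffOn ℝ ∞ e D ∧
      ∀ z ∈ D, IsLorentzFrame (e z) (fun i => v i z) := by
  set τ : Fin (n + 1) → ℝ := Pi.single 0 1 with hτ
  have hττ : lorentz τ τ = -1 := by simp [lorentz, hτ]
  set X : G → Fin (n + 1) → ℝ := fun z => τ - ∑ i, lorentz τ (v i z) • v i z with hX
  have hXs : ContDiffOn ℝ ∞ X D := contDiffOn_const.sub
    (ContDiffOn.sum fun i _ => (contDiffOn_lorentz contDiffOn_const (hv i)).smul (hv i))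
  have hXv : ∀ z ∈ D, ∀ i, lorentz (X z) (v i z) = 0 := fun z hz i => by
    simp [hX, lorentz_sub_left, lorentz_sum_left, lorentz_smul_left, h z hz]
  have hXX : ∀ z ∈ D, 0 < -lorentz (X z) (X z) := fun z hz => by
    have h1 : lorentz (X z) (X z) = lorentz (X z) τ := by
      conv_lhs => rw [hX]
      rw [lorentz_sub_right, lorentz_sum_right, Finset.sum_eq_zero fun i _ => by
        rw [lorentz_smul_right]; exact mul_eq_zero_of_right _ (hXv z hz i), sub_zero]
    have h2 : lorentz (X z) τ = -1 - ∑ i, lorentz τ (v i z) ^ 2 := by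
      rw [lorentz_comm]
      simp only [hX, lorentz_sub_right, lorentz_sum_right, lorentz_smul_right, hττ, sq]
    have h3 : 0 ≤ ∑ i, lorentz τ (v i z) ^ 2 := Finset.sum_nonneg fun i _ => sq_nonneg _
    linarith
  refine ⟨fun z => (Real.sqrt (-lorentz (X z) (X z)))⁻¹ • X z,
    contDiffOn_inv_sqrt_smul (contDiffOn_lorentz hXs hXs).neg hXs hXX, fun z hz =>
      ⟨?_, fun i => ?_, h z hz⟩⟩
  · rw [lorentz_smul_left, lorentz_smul_right]
    have := Real.sq_sqrt (hXX z hz).le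
    have h0 := (Real.sqrt_pos.mpr (hXX z hz)).ne'
    field_simp
    linarith
  · rw [lorentz_smul_left]
    exact mul_eq_zero_of_right _ (hXv z hz i)

end Smooth

/-! ### Frames of the orthogonal complement -/

/-- The real part of a complex vector. -/
def rePart {n : ℕ} (Z : Fin n → ℂ) : Fin n → ℝ := fun i => (Z i).re

/-- The imaginary part of a complex vector. -/
def imPart {n : ℕ} (Z : Fin n → ℂ) : Fin n → ℝ := fun i => (Z i).im

section Parts

variable {n : ℕ}

theorem re_lorentz_parts (Y Z : Fin (n + 1) → ℂ) : (lorentz Y Z).re =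
    lorentz (rePart Y) (rePart Z) - lorentz (imPart Y) (imPart Z) := by
  simp [lorentz, rePart, imPart]
  ring

theorem im_lorentz_parts (Y Z : Fin (n + 1) → ℂ) : (lorentz Y Z).im =
    lorentz (rePart Y) (imPart Z) + lorentz (imPart Y) (rePart Z) := by
  simp [lorentz, rePart, imPart, Finset.sum_add_distrib]
  ring

theorem re_lorentz_star_parts (Y Z : Fin (n + 1) → ℂ) : (lorentz Y (star Z)).re =
    lorentz (rePart Y) (rePart Z) + lorentz (imPart Y) (imPart Z) := by
  simp [lorentz, rePart, imPart, Finset.sum_add_distrib]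
  ring

theorem im_lorentz_star_parts (Y Z : Fin (n + 1) → ℂ) : (lorentz Y (star Z)).im =
    lorentz (imPart Y) (rePart Z) - lorentz (rePart Y) (imPart Z) := by
  simp [lorentz, rePart, imPart, Finset.sum_add_distrib]
  ring

theorem lorentz_toC_eq_zero_iff (y : Fin (n + 1) → ℝ) (Z : Fin (n + 1) → ℂ) :
    lorentz (toC y) Z = 0 ↔ lorentz y (rePart Z) = 0 ∧ lorentz y (imPart Z) = 0 := by
  have h1 : rePart (toC y) = y := rfl
  have h2 : imPart (toC y) = 0 := by funext i; simp [imPart, toC]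
  rw [Complex.ext_iff, re_lorentz_parts, im_lorentz_parts, h1, h2, lorentz_zero_left,
    lorentz_zero_left, sub_zero, add_zero]
  rfl

variable {G : Type*} [NormedAddCommGroup G] [NormedSpace ℝ G] {D : Set G}

theorem contDiffOn_rePart {Z : G → Fin n → ℂ} (hZ : ContDiffOn ℝ ∞ Z D) :
    ContDiffOn ℝ ∞ (fun z => rePart (Z z)) D :=
  contDiffOn_pi.mpr fun i => Complex.reCLM.contDiff.comp_contDiffOn (contDiffOn_pi.mp hZ i)

theorem contDiffOn_imPart {Z : G → Fin n → ℂ} (hZ : ContDiffOn ℝ ∞ Z D) :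
    ContDiffOn ℝ ∞ (fun z => imPart (Z z)) D :=
  contDiffOn_pi.mpr fun i => Complex.imCLM.contDiff.comp_contDiffOn (contDiffOn_pi.mp hZ i)

theorem contDiffOn_star {Z : G → Fin n → ℂ} (hZ : ContDiffOn ℝ ∞ Z D) :
    ContDiffOn ℝ ∞ (fun z => star (Z z)) D :=
  contDiffOn_pi.mpr fun i => Complex.conjCLE.contDiff.comp_contDiffOn (contDiffOn_pi.mp hZ i)

/-- The real and imaginary parts of two null vectors that span a totally isotropic, space-like
plane form an orthonormal family after scaling. -/
theorem lorentz_parts_orthonormal {A B : Fin (n + 1) → ℂ} (hAA : lorentz A A = 0)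
    (hAB : lorentz A B = 0) (hBB : lorentz B B = 0) (hBA : lorentz B (star A) = 0) {a b : ℝ}
    (ha : a * a * (lorentz A (star A)).re = 2) (hb : b * b * (lorentz B (star B)).re = 2)
    (i j : Fin 4) :
    lorentz (![a • rePart A, a • imPart A, b • rePart B, b • imPart B] i)
      (![a • rePart A, a • imPart A, b • rePart B, b • imPart B] j) = if i = j then 1 else 0 := by
  have e1 := congrArg Complex.re hAA
  have e2 := congrArg Complex.im hAA
  have e3 := congrArg Complex.re hAB
  have e4 := congrArg Complex.im hAB
  have e5 := congrArg Complex.re hBB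
  have e6 := congrArg Complex.im hBB
  have e7 := congrArg Complex.re hBA
  have e8 := congrArg Complex.im hBA
  rw [re_lorentz_parts, Complex.zero_re] at e1 e3 e5
  rw [im_lorentz_parts, Complex.zero_im] at e2 e4 e6
  rw [re_lorentz_star_parts] at ha hb e7
  rw [im_lorentz_star_parts] at e8
  rw [Complex.zero_re] at e7
  rw [Complex.zero_im] at e8
  rw [lorentz_comm (imPart A) (rePart A)] at e2
  rw [lorentz_comm (imPart B) (rePart B)] at e6
  rw [lorentz_comm (rePart B) (rePart A), lorentz_comm (imPart B) (imPart A)] at e7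
  rw [lorentz_comm (rePart B) (imPart A), lorentz_comm (imPart B) (rePart A)] at e8
  have hAre : a * (a * lorentz (rePart A) (rePart A)) = 1 := by
    linear_combination ha / 2 + a * a * e1 / 2
  have hAim : a * (a * lorentz (imPart A) (imPart A)) = 1 := by
    linear_combination ha / 2 - a * a * e1 / 2
  have hBre : b * (b * lorentz (rePart B) (rePart B)) = 1 := by
    linear_combination hb / 2 + b * b * e5 / 2
  have hBim : b * (b * lorentz (imPart B) (imPart B)) = 1 := by
    linear_combination hb / 2 - b * b * e5 / 2
  have hA : lorentz (rePart A) (imPart A) = 0 := by linarith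
  have hB : lorentz (rePart B) (imPart B) = 0 := by linarith
  have hrr : lorentz (rePart A) (rePart B) = 0 := by linarith
  have hii : lorentz (imPart A) (imPart B) = 0 := by linarith
  have hri : lorentz (rePart A) (imPart B) = 0 := by linarith
  have hir : lorentz (imPart A) (rePart B) = 0 := by linarith
  have hA' := (lorentz_comm (imPart A) (rePart A)).trans hA
  have hB' := (lorentz_comm (imPart B) (rePart B)).trans hB
  have hrr' := (lorentz_comm (rePart B) (rePart A)).trans hrr
  have hii' := (lorentz_comm (imPart B) (imPart A)).trans hii
  have hri' := (lorentz_comm (imPart B) (rePart A)).trans hri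
  have hir' := (lorentz_comm (rePart B) (imPart A)).trans hir
  fin_cases i <;> fin_cases j <;>
    simp [lorentz_smul_left, lorentz_smul_right, -mul_eq_zero, hAre, hAim, hBre, hBim, hA, hB,
      hrr, hii, hri, hir, hA', hB', hrr', hii', hri', hir']

end Parts

theorem smul_horizontalPart {n : ℕ} {A W : Fin (n + 1) → ℂ} (hA : lorentz A (star A) ≠ 0) :
    lorentz A (star A) • horizontalPart A W =
      lorentz A (star A) • W - lorentz W (star A) • A := by
  rw [horizontalPart, smul_sub, smul_smul, mul_div_cancel₀ _ hA]

section Curve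

variable {k : ℕ} {M : Type*} [TopologicalSpace M] [ChartedSpace ℂ M]
  {ξ : M → ℙ ℂ (Fin (k + 6) → ℂ)}

/-- The space-like frame of `V` made of the real and imaginary parts of a lift and of the
horizontal part of its derivative. -/
theorem IsChartLift.exists_orthonormal {φ : OpenPartialHomeomorph M ℂ} {D : Set ℂ}
    {Z : ℂ → Fin (k + 6) → ℂ} (h : IsChartLift ξ φ D Z) {z₀ : ℂ} (hz₀ : z₀ ∈ D)
    (hsp : IsSpacelikeAt ξ (φ.symm z₀)) :
    ∃ (D' : Set ℂ) (v : Fin 4 → ℂ → Fin (k + 6) → ℝ), IsOpen D' ∧ z₀ ∈ D' ∧ D' ⊆ D ∧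
      (∀ i, ContDiffOn ℝ ∞ (v i) D') ∧
      (∀ z ∈ D', ∀ i j, lorentz (v i z) (v j z) = if i = j then 1 else 0) ∧
      ∀ z ∈ D', ∀ y, y ∈ envelopeSpace ξ (φ.symm z) ↔ ∀ i, lorentz y (v i z) = 0 := by
  have hZ : ContDiffOn ℝ ∞ Z D :=
    (h.differentiableOn.contDiffOn (n := ∞) h.isOpen).restrict_scalars ℝ
  have hZ' : ContDiffOn ℝ ∞ (deriv Z) D :=
    ((h.differentiableOn.deriv h.isOpen).contDiffOn (n := ∞) h.isOpen).restrict_scalars ℝ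
  -- The horizontal part of Z' with its denominator cleared: orthogonal to Z for both the bilinear
  -- and the Hermitian product, and null by isotropy.
  set B : ℂ → Fin (k + 6) → ℂ := fun z => lorentz (Z z) (star (Z z)) • deriv Z z -
    lorentz (deriv Z z) (star (Z z)) • Z z with hBdef
  have hB : ContDiffOn ℝ ∞ B D :=
    ((contDiffOn_lorentz hZ (contDiffOn_star hZ)).smul hZ').sub
      ((contDiffOn_lorentz hZ' (contDiffOn_star hZ)).smul hZ)
  have hne : ∀ z ∈ D, lorentz (Z z) (star (Z z)) ≠ 0 := fun z hz h0 => by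
    have := h.pos z hz
    rw [h0] at this
    exact lt_irrefl _ this
  have hZB : ∀ z ∈ D, lorentz (Z z) (B z) = 0 := fun z hz => by
    simp [hBdef, lorentz_sub_right, lorentz_smul_right, h.null z hz, h.null_deriv z hz]
  have hBB : ∀ z ∈ D, lorentz (B z) (B z) = 0 := fun z hz => by
    simp [hBdef, lorentz_sub_right, lorentz_smul_right, lorentz_sub_left, lorentz_smul_left,
      h.null z hz, h.null_deriv z hz, h.isotropic z hz, lorentz_comm (deriv Z z) (Z z)]
  have hBZ : ∀ z, lorentz (B z) (star (Z z)) = 0 := fun z => by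
    simp only [hBdef, lorentz_sub_left, lorentz_smul_left]
    ring
  have hpos : ContDiffOn ℝ ∞ (fun z => (lorentz (Z z) (star (Z z))).re / 2) D :=
    (Complex.reCLM.contDiff.comp_contDiffOn
      (contDiffOn_lorentz hZ (contDiffOn_star hZ))).div_const 2
  have hposB : ContDiffOn ℝ ∞ (fun z => (lorentz (B z) (star (B z))).re / 2) D :=
    (Complex.reCLM.contDiff.comp_contDiffOn
      (contDiffOn_lorentz hB (contDiffOn_star hB))).div_const 2
  set D' := D ∩ (fun z => (lorentz (B z) (star (B z))).re / 2) ⁻¹' Set.Ioi 0 with hD'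
  have hD'D : D' ⊆ D := Set.inter_subset_left
  have hz₀' : z₀ ∈ D' := by
    refine ⟨hz₀, ?_⟩
    have hBh : B z₀ = lorentz (Z z₀) (star (Z z₀)) • horizontalPart (Z z₀) (deriv Z z₀) :=
      (smul_horizontalPart (hne z₀ hz₀)).symm
    rw [Set.mem_preimage, hBh, re_lorentz_smul_star]
    exact half_pos (mul_pos (Complex.normSq_pos.mpr (hne z₀ hz₀))
      (h.pos_of_isSpacelikeAt z₀ hz₀ hsp))
  have hp : ∀ z ∈ D', 0 < (lorentz (Z z) (star (Z z))).re / 2 := fun z hz =>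
    half_pos (h.pos z hz.1)
  have hpB : ∀ z ∈ D', 0 < (lorentz (B z) (star (B z))).re / 2 := fun z hz => hz.2
  set a : ℂ → ℝ := fun z => (Real.sqrt ((lorentz (Z z) (star (Z z))).re / 2))⁻¹
  set b : ℂ → ℝ := fun z => (Real.sqrt ((lorentz (B z) (star (B z))).re / 2))⁻¹
  have hnormalize : ∀ r : ℝ, 0 < r / 2 → (Real.sqrt (r / 2))⁻¹ * (Real.sqrt (r / 2))⁻¹ * r = 2 :=
    fun r hr => by
      have h1 := Real.mul_self_sqrt hr.le
      rw [← mul_inv, h1]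
      have : r ≠ 0 := by rintro rfl; simp at hr
      field_simp
  have ha0 : ∀ z ∈ D', a z ≠ 0 := fun z hz => inv_ne_zero (Real.sqrt_pos.mpr (hp z hz)).ne'
  have hb0 : ∀ z ∈ D', b z ≠ 0 := fun z hz => inv_ne_zero (Real.sqrt_pos.mpr (hpB z hz)).ne'
  have hcases : ∀ {P : Fin 4 → Prop}, (∀ i, P i) ↔ P 0 ∧ P 1 ∧ P 2 ∧ P 3 := fun {P} => by
    simp [Fin.forall_fin_succ]
  refine ⟨D', fun i z => ![a z • rePart (Z z), a z • imPart (Z z), b z • rePart (B z),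
    b z • imPart (B z)] i, hposB.continuousOn.isOpen_inter_preimage h.isOpen isOpen_Ioi, hz₀',
    hD'D, hcases.mpr ⟨?_, ?_, ?_, ?_⟩, fun z hz i j => ?_, fun z hz y => ?_⟩
  · exact contDiffOn_inv_sqrt_smul (hpos.mono hD'D) (contDiffOn_rePart (hZ.mono hD'D)) hp
  · exact contDiffOn_inv_sqrt_smul (hpos.mono hD'D) (contDiffOn_imPart (hZ.mono hD'D)) hp
  · exact contDiffOn_inv_sqrt_smul (hposB.mono hD'D) (contDiffOn_rePart (hB.mono hD'D)) hpB
  · exact contDiffOn_inv_sqrt_smul (hposB.mono hD'D) (contDiffOn_imPart (hB.mono hD'D)) hpB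
  · exact lorentz_parts_orthonormal (h.null z hz.1) (hZB z hz.1) (hBB z hz.1) (hBZ z)
      (hnormalize _ (hp z hz)) (hnormalize _ (hpB z hz)) i j
  · have hyB : lorentz (toC y) (Z z) = 0 →
        (lorentz (toC y) (deriv Z z) = 0 ↔ lorentz (toC y) (B z) = 0) := fun hy => by
      simp [hBdef, lorentz_sub_right, lorentz_smul_right, hy, hne z hz.1]
    rw [h.mem_envelopeSpace_iff z hz.1, and_congr_right hyB, lorentz_toC_eq_zero_iff,
      lorentz_toC_eq_zero_iff, hcases]
    simp [lorentz_smul_right, ha0 z hz, hb0 z hz, and_assoc]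

theorem exists_isEnvelopeFrame [IsManifold 𝓘(ℂ) ω M] (hξ : IsOneIsotropicCurve ξ) {q₀ : M}
    (hsp : IsSpacelikeAt ξ q₀) :
    ∃ (U : Set M) (e₀ : M → Fin (k + 6) → ℝ) (e : Fin (k + 1) → M → Fin (k + 6) → ℝ),
      IsOpen U ∧ q₀ ∈ U ∧ IsEnvelopeFrame ξ U e₀ e := by
  have := isManifold_real_of_complex (M := M)
  obtain ⟨D, Z, hzD, hZ⟩ := hξ.exists_isChartLift q₀
  set φ := chartAt ℂ q₀ with hφ
  have hs : q₀ ∈ φ.source := mem_chart_source ℂ q₀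
  rw [← φ.left_inv hs] at hsp
  obtain ⟨D₁, v, hD₁, hz₁, -, hv, hvv, hmem⟩ := hZ.exists_orthonormal hzD hsp
  obtain ⟨E₀, hE₀, hfr⟩ := exists_timelike hv hvv
  -- Four vectors for V and k + 1 more make k + 5 space-like ones, which together with E₀ form a
  -- basis of ℝ^{k+6}.
  obtain ⟨D₂, w, hD₂, hz₂, hD₂D, hw, hfr₂, hwv⟩ :=
    exists_isLorentzFrame_extension hD₁ hE₀ hv hfr hz₁ (k + 1) (by omega)
  have hφs : ContMDiffOn 𝓘(ℝ, ℂ) 𝓘(ℝ, ℂ) ∞ φ (φ.source ∩ φ ⁻¹' D₂) :=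
    contMDiffOn_chart.mono Set.inter_subset_left
  refine ⟨φ.source ∩ φ ⁻¹' D₂, fun q => E₀ (φ q), fun j q => w (Fin.natAdd 4 j) (φ q),
    φ.isOpen_inter_preimage hD₂, ⟨hs, hz₂⟩,
    (hE₀.mono hD₂D).contMDiffOn.comp hφs fun q hq => hq.2,
    fun j => (hw _).contMDiffOn.comp hφs fun q hq => hq.2,
    fun q hq => (hfr₂ _ hq.2).timelike, fun q hq j => (hfr₂ _ hq.2).orthogonal _,
    fun q hq i j => ?_, fun q hq => ?_⟩
  · rw [(hfr₂ _ hq.2).orthonormal]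
    simp
  · have hf := hfr₂ _ hq.2
    have hm : ∀ y, y ∈ envelopeSpace ξ q ↔ ∀ i, lorentz y (v i (φ q)) = 0 := fun y => by
      rw [← hmem _ (hD₂D hq.2), φ.left_inv hq.1]
    apply le_antisymm
    · rw [Submodule.span_le]
      rintro y (rfl | ⟨j, rfl⟩)
      · refine (hm _).mpr fun i => ?_
        rw [← hwv i]; exact hf.orthogonal _
      · refine (hm _).mpr fun i => ?_
        rw [← hwv i]
        refine (hf.orthonormal _ _).trans (if_neg ?_)
        intro h
        have := congrArg Fin.val h
        simp at this
        omega
    · intro y hy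
      -- In the full expansion of y the first four coefficients are its products with the frame of
      -- V, hence zero.
      rw [hf.eq_sum (by omega) y, Fin.sum_univ_add]
      have hzero : ∑ i : Fin 4, lorentz y (w (Fin.castAdd (k + 1) i) (φ q)) •
          w (Fin.castAdd (k + 1) i) (φ q) = 0 :=
        Finset.sum_eq_zero fun i _ => by rw [hwv i, (hm y).mp hy i, zero_smul]
      rw [hzero, zero_add]
      refine Submodule.add_mem _ (Submodule.smul_mem _ _ (Submodule.subset_span (by simp))) ?_
      exact Submodule.sum_mem _ fun j _ =>
        Submodule.smul_mem _ _ (Submodule.subset_span (Set.mem_insert_of_mem _ ⟨j, rfl⟩))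

end Curve

end Wintgen

theorem theorem4p2 {k : ℕ} {M : Type*} [TopologicalSpace M] [ChartedSpace ℂ M]
    [IsManifold 𝓘(ℂ) ω M] (ξ : M → ℙ ℂ (Fin (k + 6) → ℂ))
    (hξ : Wintgen.IsOneIsotropicCurve ξ) :
    -- local frames of `V^⊥` exist wherever the differential of `ξ` is space-like
    (∀ q₀ : M, Wintgen.IsSpacelikeAt ξ q₀ →
      ∃ (U : Set M) (e₀ : M → Fin (k + 6) → ℝ) (e : Fin (k + 1) → M → Fin (k + 6) → ℝ),
        IsOpen U ∧ q₀ ∈ U ∧ Wintgen.IsEnvelopeFrame ξ U e₀ e) ∧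
    -- every local frame parametrizes the envelope over `U` by `U × S^{m-2}`, and this is Wintgen
    -- ideal with mean curvature sphere `ξ` wherever it is immersed
    (∀ (U : Set M) (e₀ : M → Fin (k + 6) → ℝ) (e : Fin (k + 1) → M → Fin (k + 6) → ℝ),
      IsOpen U → Wintgen.IsEnvelopeFrame ξ U e₀ e →
        ContMDiffOn (𝓘(ℝ, ℂ).prod (𝓡 k)) 𝓘(ℝ, EuclideanSpace ℝ (Fin (k + 5))) ∞
          (Wintgen.envelopeMap e₀ e) (U ×ˢ Set.univ) ∧
        Set.BijOn (fun p : M × Wintgen.FiberSphere k => (p.1, Wintgen.envelopeMap e₀ e p))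
          (U ×ˢ Set.univ) {z ∈ Wintgen.envelope ξ | z.1 ∈ U} ∧
        ∀ p ∈ U ×ˢ (Set.univ : Set (Wintgen.FiberSphere k)),
          Wintgen.IsImmersedAt (𝓘(ℝ, ℂ).prod (𝓡 k)) (Wintgen.envelopeMap e₀ e) p →
          Wintgen.IsWintgenIdealAt (𝓘(ℝ, ℂ).prod (𝓡 k)) (Wintgen.envelopeMap e₀ e) p ∧
          Wintgen.HasMeanCurvatureSphere (𝓘(ℝ, ℂ).prod (𝓡 k)) (Wintgen.envelopeMap e₀ e) p
            (ξ p.1)) ∧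
    -- the same for every `m`-dimensional immersed piece of the envelope
    (∀ {E : Type*} [NormedAddCommGroup E] [NormedSpace ℝ E] [FiniteDimensional ℝ E]
      {H : Type*} [TopologicalSpace H] (I : ModelWithCorners ℝ E H) [I.Boundaryless]
      {N : Type*} [TopologicalSpace N] [ChartedSpace H N] [IsManifold I ∞ N]
      (π : N → M) (f : N → EuclideanSpace ℝ (Fin (k + 5))) (W : Set N),
      Module.finrank ℝ E = k + 2 → IsOpen W → ContMDiffOn I 𝓘(ℝ, ℂ) ∞ π W →
      ContMDiffOn I 𝓘(ℝ, EuclideanSpace ℝ (Fin (k + 5))) ∞ f W →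
      (∀ p ∈ W, (π p, f p) ∈ Wintgen.envelope ξ) →
      ∀ p ∈ W, Wintgen.IsImmersedAt I f p →
        Wintgen.IsWintgenIdealAt I f p ∧ Wintgen.HasMeanCurvatureSphere I f p (ξ (π p))) := by
  refine ⟨fun q₀ hq₀ => Wintgen.exists_isEnvelopeFrame hξ hq₀, fun U e₀ e hU he =>
    ⟨he.contMDiffOn, he.bijOn, fun p hp him => he.isWintgenIdealAt hξ hU hp.1 him⟩, ?_⟩
  intro E _ _ _ H _ I _ N _ _ _ π f W hE hW hπ hf hπf p hp him
  exact Wintgen.isWintgenIdealAt_of_mem_envelope hξ hE hW hπ hf hπf hp him
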